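/- \textbf{(Existence of invariant zooming measures.)} Let $X$ be a compact, locally connected metric space, let $f:X\to X$ be a Borel measurable map and let $\delta>0$. Let $\alpha=(\alpha_n)_{n\ge 1}$ be a zooming contraction, i.e. a sequence of nondecreasing functions $\alpha_n:[0,\infty)\to[0,\infty)$ such that $\alpha_n(r)<r$ and $\alpha_n(\alpha_m(r))\le\alpha_{n+m}(r)$ for all $r>0$, $n,m\ge1$, and $\sup_{0\le r\le 1}\sum_{n\ge1}\alpha_n(r)<\infty$. An integer $n\ge1$ is an $(\alpha,\delta)$-zooming time of $p\in X$ if $p$ has an open neighbourhood $V$ (a zooming pre-ball of order $n$ of $p$) such that $f^n(V)=B_\delta(f^n(p))$, $f^n$ maps $\overline V$ homeomorphically onto $\overline{B_\delta(f^n(p))}$, and $\operatorname{dist}(f^j(x),f^j(y))\le\alpha_{n-j}(\operatorname{dist}(f^n(x),f^n(y)))$ for all $x,y\in V$ and $0\le j<n$. Let $Z_n$ be the set of points having $n$ as a zooming time. Let $\mu$ be a zooming measure: a finite Borel measure on $X$ with $f_*\mu\ll\mu$ such that $\mu$-almost every $x$ has infinitely many zooming times and satisfies $\limsup_{n\to\infty}\frac1n\#\{1\le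 j\le n : x\in Z_j\}>0$. Suppose that $\mu$ has bounded distortion: there is $\rho>0$ such that for every $n\ge 1$ and $\mu$-almost every $p\in Z_n$ there is a zooming pre-ball $V$ of order $n$ of $p$ on which $f^n$ has a Jacobian $J_\mu f^n$ with respect to $\mu$ (an integrable function on $V$ with $\mu(f^n(A))=\int_A J_\mu f^n\,d\mu$ for all Borel $A\subset V$), positive $\mu$-almost everywhere on $V$, with $$\left|\log\frac{J_\mu f^n(x)}{J_\mu f^n(y)}\right|\le\rho\operatorname{dist}(f^n(x),f^n(y))\quad\text{for $\mu$-almost all }x,y\in V.$$ Then there is a finite collection of ergodic $f$-invariant Borel probability measures, each absolutely continuous with respect to $\mu$, such that $\mu$-almost every $x\in X$ lies in the basin of one of them; the basin of $\eta$ is the set of $x$ with $\lim_{n\to\infty}\frac1n\sum_{j=0}^{n-1}\varphi(f^j(x))=\int\varphi\,d\eta$ for every continuous $\varphi:X\to\mathbb R$. -/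

import Mathlib

open MeasureTheory Filter Topology
open scoped NNReal ENNReal

/-- A zooming contraction `(α_n)_{n ≥ 1}`, `α_n : [0,∞) → [0,∞)` nondecreasing. The function `α 0`
is never used. -/
structure IsZoomingContraction (α : ℕ → ℝ≥0 → ℝ≥0) : Prop where
  mono : ∀ n, 1 ≤ n → Monotone (α n)
  lt_self : ∀ n, 1 ≤ n → ∀ r, 0 < r → α n r < r
  comp_le : ∀ n m, 1 ≤ n → 1 ≤ m → ∀ r, 0 < r → α n (α m r) ≤ α (n + m) r
  sup_sum_lt_top : (⨆ (r : ℝ≥0) (_ : r ≤ 1), ∑' n : ℕ, (α (n + 1) r : ℝ≥0∞)) < ⊤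

section Zooming

variable {X : Type*} [MetricSpace X]

/-- `V` is an `(α,δ)`-zooming pre-ball of order `n` of the point `p`: an open neighbourhood of `p`
which `f^n` maps onto the ball `B_δ(f^n(p))`, such that `f^n` maps `closure V` homeomorphically
onto the closure of this ball, with backward contraction by `α` along the orbit. -/
structure IsZoomingPreBall (α : ℕ → ℝ≥0 → ℝ≥0) (δ : ℝ) (f : X → X) (n : ℕ) (p : X)
    (V : Set X) : Prop where
  isOpen : IsOpen V
  mem : p ∈ V
  image_eq : f^[n] '' V = Metric.ball (f^[n] p) δ
  homeo : ∃ h : closure V ≃ₜ closure (Metric.ball (f^[n] p) δ),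
    ∀ x : closure V, (h x : X) = f^[n] x
  contract : ∀ x ∈ V, ∀ y ∈ V, ∀ j < n,
    nndist (f^[j] x) (f^[j] y) ≤ α (n - j) (nndist (f^[n] x) (f^[n] y))

/-- The set `Z_n(α,δ,f)` of the points for which `n` is an `(α,δ)`-zooming time. -/
def zoomingTimeSet (α : ℕ → ℝ≥0 → ℝ≥0) (δ : ℝ) (f : X → X) (n : ℕ) : Set X :=
  {p | 1 ≤ n ∧ ∃ V : Set X, IsZoomingPreBall α δ f n p V}

variable [MeasurableSpace X]

/-- Weak zooming measures: finite, non-singular (`f_* μ ≪ μ`, `f` measurable), and almost every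
point has infinitely many zooming times. -/
structure IsWeakZoomingMeasure (α : ℕ → ℝ≥0 → ℝ≥0) (δ : ℝ) (f : X → X) (μ : Measure X) :
    Prop where
  finite : IsFiniteMeasure μ
  nonsingular : Measure.QuasiMeasurePreserving f μ μ
  infinite_times : ∀ᵐ x ∂μ, {n : ℕ | x ∈ zoomingTimeSet α δ f n}.Infinite

/-- Zooming measures: weak zooming measures such that almost every point has a positive upper
frequency of zooming times. -/
structure IsZoomingMeasure (α : ℕ → ℝ≥0 → ℝ≥0) (δ : ℝ) (f : X → X) (μ : Measure X) : Prop
    extends IsWeakZoomingMeasure α δ f μ where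
  frequency : ∀ᵐ x ∂μ,
    0 < limsup (fun n : ℕ =>
      (({j : ℕ | 1 ≤ j ∧ j ≤ n ∧ x ∈ zoomingTimeSet α δ f j}.ncard : ℝ) / n)) atTop

/-- `J` is a Jacobian of `g` on `V` with respect to the (finite) measure `μ`. -/
structure IsJacobianOn (μ : Measure X) (g : X → X) (V : Set X) (J : X → ℝ) : Prop where
  integrableOn : IntegrableOn J V μ
  measure_image : ∀ A ⊆ V, MeasurableSet A → Set.InjOn g A →
    μ.real (g '' A) = ∫ x in A, J x ∂μ

/-- Bounded distortion of the Jacobians of the iterates of `f` at the zooming times. Positivity of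
`J` is what makes the logarithm of the quotient meaningful. -/
def HasBoundedZoomingDistortion (α : ℕ → ℝ≥0 → ℝ≥0) (δ : ℝ) (f : X → X) (μ : Measure X) :
    Prop :=
  ∃ ρ : ℝ, 0 < ρ ∧ ∀ n : ℕ, ∀ᵐ p ∂μ, p ∈ zoomingTimeSet α δ f n →
    ∃ V : Set X, IsZoomingPreBall α δ f n p V ∧
      ∃ J : X → ℝ, IsJacobianOn μ f^[n] V J ∧
        (∀ᵐ x ∂(μ.restrict V), 0 < J x) ∧
        ∀ᵐ x ∂(μ.restrict V), ∀ᵐ y ∂(μ.restrict V),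
          |Real.log (J x / J y)| ≤ ρ * dist (f^[n] x) (f^[n] y)

/-- The basin of the measure `η`: the points whose Birkhoff averages of every continuous function
converge to its `η`-integral. -/
def measureBasin (f : X → X) (η : Measure X) : Set X :=
  {x | ∀ φ : C(X, ℝ), Tendsto (fun n : ℕ => birkhoffAverage ℝ f φ n x) atTop (𝓝 (∫ z, φ z ∂η))}

end Zooming

/-!
Pullbacks of small connected sets along zooming times form a family of Vitali type: if a pullback
of order `n` meets a pullback of order `m ≤ n`, it is absorbed by the pullback of a ball of a
somewhat larger radius, since it is connected and its image under `f^m` is small. Bounded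
distortion makes the three concentric pullbacks that occur comparable in measure, and shows that
`f^n` spreads the mass of a pullback of order `n` over the space with bounded density. These
properties are abstracted in `CoveringSystem` and verified in `exists_coveringSystem`.

*Finitely many components.* If an invariant set `U` has positive measure, then some pullback of a
ball lies in `U` up to a small proportion. Its image is, up to small measure, a ball of fixed
radius inside `U`. By compactness `U` contains one of finitely many balls of positive measure up to
a null set (`exists_finset_balls`). Hence the space splits into finitely many indecomposable
invariant sets. The restriction of `μ` to an invariant set satisfies the same hypotheses, so it
remains to find an absolutely continuous invariant probability on each component. Such a measure is
automatically ergodic, and by the pointwise ergodic theorem its basin, which is an invariant set,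
covers the component.

*Existence of an invariant measure.* Let `m` be the limit of `n⁻¹ ∑_{i < n} μ(f⁻ⁱ ·)` along an
ultrafilter. It is an invariant finitely additive content. The largest outer measure bounded by
`m` on measurable sets restricts to an invariant measure which is absolutely continuous. If it is
not zero, it can be normalized. If it is zero, there are sets `A` of almost full measure which are
visited with arbitrarily small average frequency during some window of time
(`exists_invariant_or_rarely_visited`). In that case zooming times are rare: at a zooming time `n`,
the point `f^n(x)` is distributed like `μ`, up to a constant, so it is unlikely to be outside of
`A`; and it is unlikely to be in `A` for many times `n` of the window that follows a zooming time.
Splitting the time axis into windows which begin at zooming times yields a geometric bound for the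
exponential moments of the number of zooming times (`CoveringSystem.lintegral_pow_count_le_pow`).
Comparability constants are lost in each window, but they are beaten by the choice of a large base
for the exponential. By the Borel–Cantelli lemma the zooming times of almost every point have
frequency zero, against the hypothesis. The exponential bound is essential: a positive upper
frequency at each point does not by itself keep the averages over the space away from zero.
-/

/-! ### Absolutely continuous invariant measures of a nonsingular map -/

section InvariantMeasure

variable {X : Type*} [MeasurableSpace X]

/-- The average, over the first `n` iterates, of the measures of the preimages of a set. -/
noncomputable def cesaroPreimage (μ : Measure X) (f : X → X) (n : ℕ) (t : Set X) : ℝ≥0∞ :=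
  (∑ i ∈ Finset.range n, μ (f^[i] ⁻¹' t)) / n

/-- The limit of `cesaroPreimage` along a fixed nonprincipal ultrafilter. It is finitely additive
on measurable sets and `f`-invariant, but in general not countably additive. -/
noncomputable def limitContent (μ : Measure X) (f : X → X) (t : Set X) : ℝ≥0∞ :=
  ((hyperfilter ℕ).map (fun n => cesaroPreimage μ f n t)).lim

lemma tendsto_limitContent (μ : Measure X) (f : X → X) (t : Set X) :
    Tendsto (fun n => cesaroPreimage μ f n t) (hyperfilter ℕ : Filter ℕ)
      (𝓝 (limitContent μ f t)) :=
  Ultrafilter.le_nhds_lim ((hyperfilter ℕ).map (fun n => cesaroPreimage μ f n t))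

lemma limitContent_eq_zero {μ : Measure X} {f : X → X} (hf : Measure.QuasiMeasurePreserving f μ μ)
    {t : Set X} (ht : μ t = 0) : limitContent μ f t = 0 := by
  refine tendsto_nhds_unique (tendsto_limitContent μ f t) ?_
  have : (fun n => cesaroPreimage μ f n t) = fun _ => 0 := by
    funext n
    simp [cesaroPreimage, fun i => (hf.iterate i).preimage_null ht]
  rw [this]
  exact tendsto_const_nhds

lemma limitContent_inter_add_diff {μ : Measure X} {f : X → X} (hf : Measurable f)
    (t : Set X) {s : Set X} (hs : MeasurableSet s) :
    limitContent μ f (t ∩ s) + limitContent μ f (t \ s) = limitContent μ f t := by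
  refine tendsto_nhds_unique
    ((tendsto_limitContent μ f (t ∩ s)).add (tendsto_limitContent μ f (t \ s))) ?_
  refine (tendsto_limitContent μ f t).congr fun n => ?_
  simp only [cesaroPreimage]
  rw [← ENNReal.add_div, ← Finset.sum_add_distrib]
  congr 1
  refine Finset.sum_congr rfl fun i _ => ?_
  rw [Set.preimage_inter, Set.preimage_sdiff]
  exact (measure_inter_add_sdiff _ (hf.iterate i hs)).symm

lemma limitContent_preimage_le {μ : Measure X} [IsFiniteMeasure μ] {f : X → X} (t : Set X) :
    limitContent μ f (f ⁻¹' t) ≤ limitContent μ f t := by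
  have h0 : Tendsto (fun n : ℕ => μ Set.univ / n) (hyperfilter ℕ : Filter ℕ) (𝓝 0) := by
    simpa using (ENNReal.Tendsto.const_div (a := μ Set.univ) ENNReal.tendsto_nat_nhds_top
      (Or.inr (measure_ne_top μ _))).mono_left Nat.hyperfilter_le_atTop
  have h1 := (tendsto_limitContent μ f t).add h0
  rw [add_zero] at h1
  refine le_of_tendsto_of_tendsto' (tendsto_limitContent μ f (f ⁻¹' t)) h1 fun n => ?_
  simp only [cesaroPreimage]
  rw [← ENNReal.add_div]
  gcongr
  have : ∀ i, f^[i] ⁻¹' (f ⁻¹' t) = f^[i + 1] ⁻¹' t := fun i => by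
    rw [Function.iterate_succ', Set.preimage_comp]
  simp only [this]
  calc ∑ i ∈ Finset.range n, μ (f^[i + 1] ⁻¹' t)
      ≤ ∑ i ∈ Finset.range (n + 1), μ (f^[i] ⁻¹' t) := by
        rw [Finset.sum_range_succ']; exact le_self_add
    _ ≤ _ := by
        rw [Finset.sum_range_succ]; gcongr; exact Set.subset_univ _

lemma limitContent_le_univ {μ : Measure X} {f : X → X} (t : Set X) :
    limitContent μ f t ≤ μ Set.univ := by
  refine le_of_tendsto' (tendsto_limitContent μ f t) fun n => ?_
  refine ENNReal.div_le_of_le_mul ?_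
  calc ∑ i ∈ Finset.range n, μ (f^[i] ⁻¹' t)
      ≤ ∑ i ∈ Finset.range n, μ Set.univ :=
        Finset.sum_le_sum fun i _ => measure_mono (Set.subset_univ _)
    _ = _ := by simp [mul_comm]

open Classical in
/-- The largest outer measure bounded on measurable sets by `limitContent`. Its restriction to
measurable sets is the countably additive part of that content. -/
noncomputable def limitOuterMeasure (μ : Measure X) (f : X → X)
    (h : limitContent μ f ∅ = 0) : OuterMeasure X :=
  OuterMeasure.ofFunction (fun t => if MeasurableSet t then limitContent μ f t else ⊤)
    (by simp [h])

/-- Dichotomy for a nonsingular map of a finite measure space: either there is an absolutely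
continuous invariant probability measure, or some set of almost full measure is visited with
arbitrarily small average frequency over a suitable initial window of time. -/
theorem exists_invariant_or_rarely_visited (μ : Measure X) [IsFiniteMeasure μ] {f : X → X}
    (hf : Measure.QuasiMeasurePreserving f μ μ) :
    (∃ ν : Measure X, IsProbabilityMeasure ν ∧ MeasurePreserving f ν ν ∧ ν ≪ μ) ∨
    ∀ ε : ℝ≥0∞, 0 < ε → ∃ A, MeasurableSet A ∧ μ Aᶜ ≤ ε ∧ ∃ N : ℕ, 0 < N ∧
      ∑ i ∈ Finset.range N, μ (f^[i] ⁻¹' A) ≤ ε * N := by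
  classical
  have h0 : limitContent μ f ∅ = 0 := limitContent_eq_zero hf measure_empty
  set O := limitOuterMeasure μ f h0 with hO
  have hOle : ∀ t, O t ≤ if MeasurableSet t then limitContent μ f t else ⊤ :=
    fun t => OuterMeasure.ofFunction_le t
  have hcar : ‹MeasurableSpace X› ≤ O.caratheodory := by
    intro s hs
    refine OuterMeasure.ofFunction_caratheodory fun t => ?_
    by_cases ht : MeasurableSet t
    · simp only [ht, ht.inter hs, ht.diff hs, if_true]
      exact (limitContent_inter_add_diff hf.measurable t hs).le
    · simp [ht]
  -- by maximality of `O` it suffices to compare its push-forward with the invariant content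
  have hmap : OuterMeasure.map f O ≤ O := by
    refine OuterMeasure.le_ofFunction.2 fun s => ?_
    rw [OuterMeasure.map_apply]
    split_ifs with hs
    · refine (hOle _).trans ?_
      rw [if_pos (hf.measurable hs)]
      exact limitContent_preimage_le s
    · exact le_top
  set κ : Measure X := O.toMeasure hcar with hκ
  have hκO : ∀ s, MeasurableSet s → κ s = O s := fun s hs => toMeasure_apply O hcar hs
  have hκuniv : κ Set.univ ≤ μ Set.univ := by
    rw [hκO _ MeasurableSet.univ]
    refine (hOle _).trans ?_
    rw [if_pos MeasurableSet.univ]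
    exact limitContent_le_univ _
  have : IsFiniteMeasure κ := ⟨hκuniv.trans_lt (measure_lt_top μ _)⟩
  have hκmap : κ.map f = κ := by
    refine Measure.eq_of_le_of_measure_univ_eq (Measure.le_iff.2 fun s hs => ?_) ?_
    · rw [Measure.map_apply hf.measurable hs, hκO _ (hf.measurable hs), hκO _ hs]
      exact hmap s
    · rw [Measure.map_apply hf.measurable MeasurableSet.univ, Set.preimage_univ]
  have hκac : κ ≪ μ := by
    refine Measure.AbsolutelyContinuous.mk fun s hs h => ?_
    rw [hκO s hs]
    refine le_antisymm ((hOle s).trans ?_) (zero_le)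
    rw [if_pos hs, limitContent_eq_zero hf h]
  by_cases hz : κ Set.univ = 0
  · right
    intro ε hε
    -- the countably additive part vanishes: cover the space by sets of small total content
    have h1 : O Set.univ < ε := by rw [← hκO _ MeasurableSet.univ, hz]; exact hε
    rw [hO, limitOuterMeasure, OuterMeasure.ofFunction_apply] at h1
    simp only [iInf_lt_iff] at h1
    obtain ⟨t, htc, hts⟩ := h1
    have htm : ∀ k, MeasurableSet (t k) := by
      intro k
      by_contra hk
      have := (ENNReal.le_tsum k).trans_lt hts
      simp [hk] at this
    simp only [htm, if_true] at hts
    have hUm : ∀ K, MeasurableSet (Set.accumulate t K) := fun K => by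
      simpa [Set.accumulate_def] using
        MeasurableSet.biUnion (Set.to_countable {y | y ≤ K}) fun k _ => htm k
    have hL : ∀ K, limitContent μ f (Set.accumulate t K)
        ≤ ∑ k ∈ Finset.range (K + 1), limitContent μ f (t k) := by
      have hsub : ∀ s u, MeasurableSet s → limitContent μ f u ≤
          limitContent μ f s + limitContent μ f (u \ s) := by
        intro s u hs
        have h1 := limitContent_inter_add_diff (μ := μ) hf.measurable u hs
        have h2 := limitContent_inter_add_diff (μ := μ) hf.measurable s hs
        rw [← h1]
        gcongr
        refine le_of_tendsto_of_tendsto' (tendsto_limitContent μ f _)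
          (tendsto_limitContent μ f _) fun n => ?_
        simp only [cesaroPreimage]
        gcongr
        exact Set.inter_subset_right
      have hmono : ∀ s u, s ⊆ u → limitContent μ f s ≤ limitContent μ f u := by
        intro s u hsu
        refine le_of_tendsto_of_tendsto' (tendsto_limitContent μ f _)
          (tendsto_limitContent μ f _) fun n => ?_
        simp only [cesaroPreimage]
        gcongr
      intro K
      induction K with
      | zero => simp
      | succ K ih =>
        rw [Set.accumulate_succ, Finset.sum_range_succ]
        refine (hsub _ _ (hUm K)).trans ?_
        gcongr
        exact hmono _ _ (by rintro x ⟨hx | hx, h⟩; exacts [absurd hx h, hx])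
    have hcompl : Tendsto (fun K => μ (Set.accumulate t K)ᶜ) atTop (𝓝 0) := by
      have : Tendsto (fun K => μ (Set.accumulate t K)ᶜ) atTop
          (𝓝 (μ (⋂ K, (Set.accumulate t K)ᶜ))) := by
        refine tendsto_measure_iInter_atTop (fun K => (hUm K).compl.nullMeasurableSet) ?_
          ⟨0, measure_ne_top _ _⟩
        intro a b hab
        exact Set.compl_subset_compl.2 (Set.monotone_accumulate hab)
      rwa [← Set.compl_iUnion, Set.iUnion_accumulate, Set.univ_subset_iff.1 htc, Set.compl_univ,
        measure_empty] at this
    obtain ⟨K, hK⟩ := ((tendsto_order.1 hcompl).2 ε hε).exists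
    refine ⟨Set.accumulate t K, hUm K, hK.le, ?_⟩
    have hlt : limitContent μ f (Set.accumulate t K) < ε :=
      ((hL K).trans (ENNReal.sum_le_tsum _)).trans_lt hts
    have hev := (tendsto_order.1 (tendsto_limitContent μ f (Set.accumulate t K))).2 ε hlt
    have hpos : ∀ᶠ n : ℕ in (hyperfilter ℕ : Filter ℕ), 0 < n :=
      (eventually_gt_atTop 0).filter_mono Nat.hyperfilter_le_atTop
    obtain ⟨N, hN, hN0⟩ := (hev.and hpos).exists
    refine ⟨N, hN0, ?_⟩
    have hN' : (N : ℝ≥0∞) ≠ 0 := by exact_mod_cast hN0.ne'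
    exact (ENNReal.div_le_iff hN' (ENNReal.natCast_ne_top N)).1 hN.le
  · left
    refine ⟨(κ Set.univ)⁻¹ • κ, ?_, ?_, ?_⟩
    · exact ⟨by simp [ENNReal.inv_mul_cancel hz (measure_ne_top κ _)]⟩
    · exact ⟨hf.measurable, by rw [Measure.map_smul, hκmap]⟩
    · exact hκac.smul_left _

end InvariantMeasure

/-! ### Pointwise ergodic theorem for bounded functions -/

section Birkhoff

variable {X : Type*}

lemma partialSups_birkhoffSum_le {f : X → X} {φ : X → ℝ} {N : ℕ} {x : X}
    (h : 0 < partialSups (fun n => birkhoffSum f φ n x) N) :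
    partialSups (fun n => birkhoffSum f φ n x) N ≤
      φ x + partialSups (fun n => birkhoffSum f φ n (f x)) N := by
  obtain ⟨n, hn, hnN⟩ := exists_partialSups_eq (fun n => birkhoffSum f φ n x) N
  rw [hnN] at h ⊢
  cases n with
  | zero => simp at h
  | succ n =>
    rw [birkhoffSum_succ']
    gcongr
    exact le_partialSups_of_le (fun n => birkhoffSum f φ n (f x)) (by omega)

variable [MeasurableSpace X]

lemma measurable_birkhoffSum {f : X → X} (hf : Measurable f) {φ : X → ℝ} (hφ : Measurable φ)
    (n : ℕ) : Measurable fun x => birkhoffSum f φ n x := by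
  unfold birkhoffSum
  exact Finset.measurable_fun_sum _ fun i _ => hφ.comp (hf.iterate i)

lemma measurable_partialSups_birkhoffSum {f : X → X} (hf : Measurable f) {φ : X → ℝ}
    (hφ : Measurable φ) (N : ℕ) :
    Measurable fun x => partialSups (fun n => birkhoffSum f φ n x) N := by
  induction N with
  | zero => simp
  | succ N ih =>
    simp only [← Order.succ_eq_add_one, partialSups_succ]
    exact ih.max (measurable_birkhoffSum hf hφ _)

/-- The maximal ergodic theorem. -/
lemma integral_indicator_partialSups_nonneg {ν : Measure X} [IsProbabilityMeasure ν] {f : X → X}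
    (hf : MeasurePreserving f ν ν) {φ : X → ℝ} (hφ : Measurable φ) {M : ℝ}
    (hM : ∀ x, |φ x| ≤ M) (N : ℕ) :
    0 ≤ ∫ x, {x | 0 < partialSups (fun n => birkhoffSum f φ n x) N}.indicator φ x ∂ν := by
  set F : X → ℝ := fun x => partialSups (fun n => birkhoffSum f φ n x) N with hF
  have hFm : Measurable F := measurable_partialSups_birkhoffSum hf.measurable hφ N
  have hF0 : ∀ x, 0 ≤ F x := fun x => by
    simpa using le_partialSups_of_le (fun n => birkhoffSum f φ n x) (Nat.zero_le N)
  have hS : ∀ n x, |birkhoffSum f φ n x| ≤ n * M := by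
    intro n x
    refine (Finset.abs_sum_le_sum_abs _ _).trans ?_
    refine (Finset.sum_le_sum fun i _ => hM _).trans ?_
    simp
  have hFb : ∀ x, ‖F x‖ ≤ N * M := by
    intro x
    rw [Real.norm_of_nonneg (hF0 x)]
    have hM0 : 0 ≤ M := (abs_nonneg _).trans (hM x)
    refine partialSups_le _ _ _ fun k hk => (le_abs_self _).trans ((hS k x).trans ?_)
    gcongr
  have hFi : Integrable F ν := .of_bound hFm.aestronglyMeasurable (N * M) (.of_forall hFb)
  have hFf : Integrable (fun x => F (f x)) ν := hf.integrable_comp_of_integrable hFi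
  have hset : MeasurableSet {x | 0 < F x} := measurableSet_lt measurable_const hFm
  have hφi : Integrable φ ν := .of_bound hφ.aestronglyMeasurable M (.of_forall hM)
  calc (0 : ℝ) = ∫ x, F x - F (f x) ∂ν := by
        rw [integral_sub hFi hFf]
        have := integral_map (μ := ν) hf.aemeasurable (f := F)
          (by rw [hf.map_eq]; exact hFm.aestronglyMeasurable)
        rw [hf.map_eq] at this
        rw [← this, sub_self]
    _ ≤ _ := by
        refine integral_mono (hFi.sub hFf) (hφi.indicator hset) fun x => ?_
        by_cases hx : 0 < F x
        · rw [Set.indicator_of_mem (by exact hx)]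
          have := partialSups_birkhoffSum_le (f := f) (φ := φ) hx
          simp only [hF] at *
          linarith
        · rw [Set.indicator_of_notMem (by exact hx)]
          have := hF0 (f x)
          linarith

/-- A function of negative mean has Birkhoff sums bounded from above: otherwise, by ergodicity,
they are almost everywhere unbounded, and the maximal ergodic theorem bounds the mean from
below by zero. -/
lemma ae_bddAbove_birkhoffSum {ν : Measure X} [IsProbabilityMeasure ν] {f : X → X}
    (hf : Ergodic f ν) {φ : X → ℝ} (hφ : Measurable φ) {M : ℝ}
    (hM : ∀ x, |φ x| ≤ M) (hneg : ∫ x, φ x ∂ν < 0) :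
    ∀ᵐ x ∂ν, BddAbove (Set.range fun n => birkhoffSum f φ n x) := by
  set E : Set X := {x | BddAbove (Set.range fun n => birkhoffSum f φ n x)} with hE
  have hEm : MeasurableSet E :=
    measurableSet_bddAbove_range fun n => measurable_birkhoffSum hf.measurable hφ n
  have hinv : f ⁻¹' E = E := by
    ext x
    simp only [hE, Set.mem_preimage, Set.mem_ofPred_eq]
    constructor
    · rintro ⟨b, hb⟩
      refine ⟨max 0 (φ x + b), ?_⟩
      rintro _ ⟨n, rfl⟩
      cases n with
      | zero => simp
      | succ n =>
        refine le_max_of_le_right ?_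
        simp only [birkhoffSum_succ']
        gcongr
        exact hb ⟨n, rfl⟩
    · rintro ⟨b, hb⟩
      refine ⟨b - φ x, ?_⟩
      rintro _ ⟨n, rfl⟩
      have := hb ⟨n + 1, rfl⟩
      simp only [birkhoffSum_succ'] at this
      simp only
      linarith
  rcases hf.toPreErgodic.measure_self_or_compl_eq_zero hEm hinv with h | h
  · exfalso
    have hlim : Tendsto (fun N => ∫ x, {x | 0 < partialSups (fun n => birkhoffSum f φ n x)
        N}.indicator φ x ∂ν) atTop (𝓝 (∫ x, φ x ∂ν)) := by
      refine tendsto_integral_of_dominated_convergence (fun _ => M) ?_ (integrable_const M) ?_ ?_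
      · intro N
        exact (hφ.indicator (measurableSet_lt measurable_const
          (measurable_partialSups_birkhoffSum hf.measurable hφ N))).aestronglyMeasurable
      · intro N
        refine .of_forall fun x => (norm_indicator_le_norm_self _ _).trans (hM x)
      · have hae : ∀ᵐ x ∂ν, x ∉ E := measure_eq_zero_iff_ae_notMem.1 h
        filter_upwards [hae] with x hx
        have : ∃ n, 0 < birkhoffSum f φ n x := by
          by_contra! hcon
          exact hx ⟨0, by rintro _ ⟨n, rfl⟩; exact hcon n⟩
        obtain ⟨n, hn⟩ := this
        refine tendsto_const_nhds.congr' ?_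
        filter_upwards [eventually_ge_atTop n] with N hN
        rw [Set.indicator_of_mem]
        exact hn.trans_le (le_partialSups_of_le (fun n => birkhoffSum f φ n x) hN)
    exact absurd (ge_of_tendsto' hlim fun N =>
      integral_indicator_partialSups_nonneg hf.toMeasurePreserving hφ hM N) (not_le.2 hneg)
  · exact mem_ae_iff.2 h

lemma ae_eventually_birkhoffAverage_lt {ν : Measure X} [IsProbabilityMeasure ν] {f : X → X}
    (hf : Ergodic f ν) {φ : X → ℝ} (hφ : Measurable φ) {M : ℝ}
    (hM : ∀ x, |φ x| ≤ M) {c : ℝ} (hc : ∫ x, φ x ∂ν < c) :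
    ∀ᵐ x ∂ν, ∀ᶠ n : ℕ in atTop, birkhoffAverage ℝ f φ n x < c := by
  obtain ⟨d, hd, hdc⟩ := exists_between hc
  have hφi : Integrable φ ν := .of_bound hφ.aestronglyMeasurable M (.of_forall hM)
  have hneg : ∫ x, (φ x - d) ∂ν < 0 := by
    rw [integral_sub hφi (integrable_const d)]
    simpa using hd
  filter_upwards [ae_bddAbove_birkhoffSum hf (hφ.sub_const d) (M := M + |d|)
    (fun x => (abs_sub _ _).trans (by gcongr; exact hM x)) hneg] with x hx
  obtain ⟨b, hb⟩ := hx
  have hlim : Tendsto (fun n : ℕ => b / n) atTop (𝓝 0) := tendsto_const_div_atTop_nhds_zero_nat b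
  filter_upwards [(tendsto_order.1 hlim).2 (c - d) (by linarith), eventually_gt_atTop 0]
    with n hn hn0
  have h1 : birkhoffSum f φ n x - n * d ≤ b := by
    have := hb ⟨n, rfl⟩
    simpa [birkhoffSum, Finset.sum_sub_distrib] using this
  have hn' : (0 : ℝ) < n := by exact_mod_cast hn0
  rw [birkhoffAverage, smul_eq_mul, inv_mul_lt_iff₀ hn']
  rw [div_lt_iff₀ hn'] at hn
  nlinarith

/-- Birkhoff's pointwise ergodic theorem, for an ergodic measure and a bounded function. -/
theorem ae_tendsto_birkhoffAverage {ν : Measure X} [IsProbabilityMeasure ν] {f : X → X}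
    (hf : Ergodic f ν) {φ : X → ℝ} (hφ : Measurable φ) {M : ℝ} (hM : ∀ x, |φ x| ≤ M) :
    ∀ᵐ x ∂ν, Tendsto (fun n : ℕ => birkhoffAverage ℝ f φ n x) atTop (𝓝 (∫ z, φ z ∂ν)) := by
  have hup : ∀ᵐ x ∂ν, ∀ k : ℕ, ∀ᶠ n : ℕ in atTop,
      birkhoffAverage ℝ f φ n x < ∫ z, φ z ∂ν + 1 / (k + 1) :=
    ae_all_iff.2 fun k => ae_eventually_birkhoffAverage_lt hf hφ hM
      (lt_add_of_pos_right _ Nat.one_div_pos_of_nat)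
  have hlo : ∀ᵐ x ∂ν, ∀ k : ℕ, ∀ᶠ n : ℕ in atTop,
      birkhoffAverage ℝ f (fun x => -φ x) n x < ∫ z, -φ z ∂ν + 1 / (k + 1) :=
    ae_all_iff.2 fun k => ae_eventually_birkhoffAverage_lt hf hφ.neg (by simpa using hM)
      (lt_add_of_pos_right _ Nat.one_div_pos_of_nat)
  filter_upwards [hup, hlo] with x hx hx'
  rw [Metric.tendsto_atTop']
  intro ε hε
  obtain ⟨k, hk⟩ := exists_nat_one_div_lt hε
  obtain ⟨N, hN⟩ := eventually_atTop.1 ((hx k).and (hx' k))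
  refine ⟨N, fun n hn => ?_⟩
  obtain ⟨h1, h2⟩ := hN n hn.le
  rw [integral_neg] at h2
  have h3 : birkhoffAverage ℝ f (fun x => -φ x) n x = -birkhoffAverage ℝ f φ n x := by
    simp [birkhoffAverage, birkhoffSum]
  rw [Real.dist_eq, abs_lt]
  constructor <;> linarith

end Birkhoff

section Basin

variable {X : Type*} [MetricSpace X] [CompactSpace X] [MeasurableSpace X] [BorelSpace X]

/-- Membership in the basin can be tested on a dense family of continuous functions. -/
lemma mem_measureBasin_of_dense {ν : Measure X} [IsProbabilityMeasure ν] {f : X → X}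
    {D : Set C(X, ℝ)} (hDd : Dense D) {x : X}
    (hx : ∀ φ ∈ D, Tendsto (fun n : ℕ => birkhoffAverage ℝ f φ n x) atTop (𝓝 (∫ z, φ z ∂ν))) :
    x ∈ measureBasin f ν := by
  intro φ
  rw [Metric.tendsto_atTop]
  intro ε hε
  obtain ⟨ψ, hψD, hψ⟩ := hDd.exists_dist_lt φ (ε := ε / 3) (by positivity)
  have hpt : ∀ y, |φ y - ψ y| ≤ ε / 3 := fun y => by
    rw [← Real.dist_eq]; exact (ContinuousMap.dist_apply_le_dist y).trans hψ.le
  obtain ⟨N, hN⟩ := Metric.tendsto_atTop.1 (hx ψ hψD) (ε / 3) (by positivity)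
  refine ⟨max N 1, fun n hn => ?_⟩
  have h1 := hN n (le_of_max_le_left hn)
  have hn0 : (0 : ℝ) < n := by exact_mod_cast (le_of_max_le_right hn : 1 ≤ n)
  have h2 : |birkhoffAverage ℝ f φ n x - birkhoffAverage ℝ f ψ n x| ≤ ε / 3 := by
    simp only [birkhoffAverage, birkhoffSum, smul_eq_mul]
    rw [← mul_sub, ← Finset.sum_sub_distrib, abs_mul, abs_of_pos (inv_pos.2 hn0),
      inv_mul_le_iff₀ hn0]
    refine (Finset.abs_sum_le_sum_abs _ _).trans ((Finset.sum_le_sum fun i _ => hpt _).trans ?_)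
    simp
  have hi : ∀ χ : C(X, ℝ), Integrable (fun z => χ z) ν := fun χ =>
    .of_bound χ.continuous.measurable.aestronglyMeasurable ‖χ‖
      (.of_forall fun x => χ.norm_coe_le_norm x)
  have h3 : |∫ z, φ z ∂ν - ∫ z, ψ z ∂ν| ≤ ε / 3 := by
    rw [← integral_sub (hi φ) (hi ψ)]
    simpa using norm_integral_le_of_norm_le_const (μ := ν) (f := fun z => φ z - ψ z)
      (.of_forall hpt)
  rw [Real.dist_eq] at h1 ⊢
  rw [abs_le] at h2 h3
  rw [abs_lt] at h1 ⊢
  constructor <;> linarith [h1.1, h1.2, h2.1, h2.2, h3.1, h3.2]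

lemma measurableSet_measureBasin {ν : Measure X} [IsProbabilityMeasure ν] {f : X → X}
    (hf : Measurable f) : MeasurableSet (measureBasin f ν) := by
  obtain ⟨D, hDc, hDd⟩ := TopologicalSpace.exists_countable_dense C(X, ℝ)
  have : measureBasin f ν = ⋂ φ ∈ D, {x | Tendsto (fun n : ℕ => birkhoffAverage ℝ f φ n x) atTop
      (𝓝 (∫ z, φ z ∂ν))} := by
    ext x
    simp only [Set.mem_iInter]
    exact ⟨fun h φ _ => h φ, fun h => mem_measureBasin_of_dense hDd h⟩
  rw [this]
  refine .biInter hDc fun φ _ => measurableSet_tendsto _ fun n => ?_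
  exact (measurable_birkhoffSum hf φ.continuous.measurable n).const_mul ((n : ℝ)⁻¹)

/-- An ergodic probability measure gives full measure to its basin. -/
theorem ae_mem_measureBasin {ν : Measure X} [IsProbabilityMeasure ν] {f : X → X}
    (hf : Ergodic f ν) : ∀ᵐ x ∂ν, x ∈ measureBasin f ν := by
  obtain ⟨D, hDc, hDd⟩ := TopologicalSpace.exists_countable_dense C(X, ℝ)
  have h : ∀ᵐ x ∂ν, ∀ φ ∈ D, Tendsto (fun n : ℕ => birkhoffAverage ℝ f φ n x) atTop
      (𝓝 (∫ z, φ z ∂ν)) :=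
    (ae_ball_iff hDc).2 fun φ _ => ae_tendsto_birkhoffAverage hf φ.continuous.measurable
      (M := ‖φ‖) fun x => φ.norm_coe_le_norm x
  filter_upwards [h] with x hx
  exact mem_measureBasin_of_dense hDd hx

end Basin

/-- Time averages are insensitive to one step of the dynamics. -/
lemma preimage_measureBasin {X : Type*} [MetricSpace X] [CompactSpace X] [MeasurableSpace X]
    (f : X → X) (ν : Measure X) :
    f ⁻¹' measureBasin f ν = measureBasin f ν := by
  ext x
  simp only [measureBasin, Set.mem_preimage, Set.mem_ofPred_eq]
  refine forall_congr' fun φ => ?_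
  have h0 : Tendsto (fun n => birkhoffAverage ℝ f φ n (f x) - birkhoffAverage ℝ f φ n x)
      atTop (𝓝 0) := by
    refine tendsto_birkhoffAverage_apply_sub_birkhoffAverage ℝ ?_
    exact (isCompact_range φ.continuous).isBounded.subset
      (by rintro _ ⟨n, rfl⟩; exact ⟨_, rfl⟩)
  constructor
  · intro h; simpa using h.sub h0
  · intro h; simpa using h.add h0

/-! ### Covering systems and the frequency of their visits -/

/-- A family of nested triples `core ⊆ mid ⊆ outer` of sets with an order (a time), which mimics
the pullbacks, under `f^n`, of three concentric balls. Cores of higher order that meet a core, or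
a middle set, are absorbed by the next larger set; the three sets have comparable measures; and
`f^n` distributes an outer set of order `n` over the space with density at most `K`. -/
structure CoveringSystem {X : Type*} [TopologicalSpace X] [MeasurableSpace X] (ι : Type*)
    (μ : Measure X) (f : X → X) (C K : ℝ≥0∞) where
  ord : ι → ℕ
  core : ι → Set X
  mid : ι → Set X
  outer : ι → Set X
  isOpen_core : ∀ i, IsOpen (core i)
  measurableSet_mid : ∀ i, MeasurableSet (mid i)
  nonempty_core : ∀ i, (core i).Nonempty
  core_subset_mid : ∀ i, core i ⊆ mid i
  mid_subset_outer : ∀ i, mid i ⊆ outer i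
  core_subset_mid_of_inter : ∀ i j, ord i ≤ ord j → (core j ∩ core i).Nonempty → core j ⊆ mid i
  core_subset_outer_of_inter : ∀ i j, ord i ≤ ord j → (core j ∩ mid i).Nonempty → core j ⊆ outer i
  measure_outer_le : ∀ i, μ (outer i) ≤ C * μ (core i)
  measure_outer_inter_preimage_le : ∀ i A, MeasurableSet A →
    μ (outer i ∩ f^[ord i] ⁻¹' A) ≤ K * μ (outer i) * μ A

namespace CoveringSystem

variable {X : Type*} [TopologicalSpace X] [MeasurableSpace X] {ι : Type*} {μ : Measure X}
  {f : X → X} {C K : ℝ≥0∞}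
  (S : CoveringSystem ι μ f C K)

lemma measure_mid_le (i : ι) : μ (S.mid i) ≤ C * μ (S.core i) :=
  (measure_mono (S.mid_subset_outer i)).trans (S.measure_outer_le i)

lemma measure_outer_le_mid (i : ι) : μ (S.outer i) ≤ C * μ (S.mid i) :=
  (S.measure_outer_le i).trans (by gcongr; exact S.core_subset_mid i)

/-- The points which lie in a core of order `n`. -/
def visit (n : ℕ) : Set X := ⋃ (i : ι) (_ : S.ord i = n), S.core i

lemma mem_visit {n : ℕ} {x : X} : x ∈ S.visit n ↔ ∃ i, S.ord i = n ∧ x ∈ S.core i := by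
  simp [visit]

/-- The number of times in `[s, N)` at which the point lies in a core. -/
noncomputable def count (s N : ℕ) (x : X) : ℕ :=
  ∑ n ∈ Finset.Ico s N, (S.visit n).indicator (fun _ => 1) x

lemma count_anti {s s' : ℕ} (h : s ≤ s') (N : ℕ) (x : X) : S.count s' N x ≤ S.count s N x :=
  Finset.sum_le_sum_of_subset (Finset.Ico_subset_Ico_left h)

lemma count_le_add (s m N : ℕ) (hs : s ≤ m) (x : X) :
    S.count s N x ≤ S.count s m x + S.count m N x := by
  rcases le_total m N with h | h
  · rw [count, count, count, Finset.sum_Ico_consecutive _ hs h]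
  · exact (Finset.sum_le_sum_of_subset (Finset.Ico_subset_Ico_right h)).trans le_self_add

lemma count_le (s m : ℕ) (x : X) : S.count s (s + m) x ≤ m := by
  refine (Finset.sum_le_card_nsmul _ _ 1 fun n _ => ?_).trans (by simp)
  exact Set.indicator_le_self' (by simp) x

/-- If the count is positive, the point lies in a core at the first time that counts. -/
lemma exists_core_of_count_ne_zero {s N : ℕ} {x : X} (h : S.count s N x ≠ 0) :
    ∃ i, s ≤ S.ord i ∧ x ∈ S.core i ∧ S.count s N x ≤ S.count (S.ord i) N x := by
  classical
  have hex : ∃ n, n ∈ Finset.Ico s N ∧ x ∈ S.visit n := by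
    by_contra! hcon
    exact h (Finset.sum_eq_zero fun n hn => Set.indicator_of_notMem (hcon n hn) _)
  obtain ⟨hn, hx⟩ := Nat.find_spec hex
  obtain ⟨i, hi, hxi⟩ := S.mem_visit.1 hx
  rw [Finset.mem_Ico] at hn
  refine ⟨i, hi ▸ hn.1, hxi, ?_⟩
  rw [hi]
  refine (S.count_le_add s _ N hn.1 x).trans ?_
  rw [add_le_iff_nonpos_left, nonpos_iff_eq_zero]
  refine Finset.sum_eq_zero fun k hk => Set.indicator_of_notMem (fun hxk => ?_) _
  rw [Finset.mem_Ico] at hk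
  exact Nat.find_min hex hk.2 ⟨Finset.mem_Ico.2 ⟨hk.1, hk.2.trans hn.2⟩, hxk⟩

lemma ncard_le_count {x : X} {Z : ℕ → Set X} (hZ : ∀ j, x ∈ Z j → x ∈ S.visit j) (n : ℕ) :
    {j : ℕ | 1 ≤ j ∧ j ≤ n ∧ x ∈ Z j}.ncard ≤ S.count 0 (n + 1) x := by
  classical
  have hcount : S.count 0 (n + 1) x = ((Finset.range (n + 1)).filter (x ∈ S.visit ·)).card := by
    rw [Finset.card_filter, count, Finset.range_eq_Ico]
    exact Finset.sum_congr rfl fun k _ => by simp [Set.indicator_apply]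
  rw [hcount, ← Set.ncard_coe_finset]
  refine Set.ncard_le_ncard (fun j hj => ?_) (Finset.finite_toSet _)
  simpa using ⟨hj.2.1, hZ j hj.2.2⟩

lemma limsup_frequency_le_zero {x : X} {Z : ℕ → Set X} (hZ : ∀ j, x ∈ Z j → x ∈ S.visit j)
    (h : ∀ Q : ℕ, ∃ w : ℕ, 0 < w ∧ ∀ᶠ k : ℕ in atTop, Q * S.count 0 (k * w) x < k * w) :
    limsup (fun n : ℕ => (({j : ℕ | 1 ≤ j ∧ j ≤ n ∧ x ∈ Z j}.ncard : ℝ) / n)) atTop ≤ 0 := by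
  refine le_of_forall_pos_le_add fun ε hε => ?_
  rw [zero_add]
  obtain ⟨Q, hQ⟩ := exists_nat_gt (2 / ε)
  have hQ0 : (0 : ℝ) < Q := lt_trans (by positivity) hQ
  obtain ⟨w, hw, hk⟩ := h Q
  refine limsup_le_of_le (isCoboundedUnder_le_of_le atTop (x := 0) fun n => by positivity) ?_
  have hdiv : Tendsto (fun n : ℕ => n / w + 1) atTop atTop :=
    (tendsto_add_atTop_nat 1).comp (Nat.tendsto_div_const_atTop hw.ne')
  filter_upwards [hdiv.eventually hk, eventually_ge_atTop w] with n hn hnw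
  have hn0 : (0 : ℝ) < n := by exact_mod_cast hw.trans_le hnw
  have h1 : n + 1 ≤ (n / w + 1) * w := by
    have := Nat.lt_div_mul_add hw (a := n)
    rw [add_mul]; omega
  have h2 : (n / w + 1) * w ≤ 2 * n := by
    have := Nat.div_mul_le_self n w
    rw [add_mul]; omega
  have h3 : S.count 0 (n + 1) x ≤ S.count 0 ((n / w + 1) * w) x :=
    Finset.sum_le_sum_of_subset (Finset.Ico_subset_Ico_right h1)
  have h4 : Q * {j : ℕ | 1 ≤ j ∧ j ≤ n ∧ x ∈ Z j}.ncard ≤ 2 * n :=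
    ((Nat.mul_le_mul_left Q ((S.ncard_le_count hZ n).trans h3)).trans hn.le).trans h2
  have h5 : (Q : ℝ) * {j : ℕ | 1 ≤ j ∧ j ≤ n ∧ x ∈ Z j}.ncard ≤ 2 * n := by exact_mod_cast h4
  rw [div_le_iff₀ hn0]
  rw [div_lt_iff₀ hε] at hQ
  have h6 : (Q : ℝ) * {j : ℕ | 1 ≤ j ∧ j ≤ n ∧ x ∈ Z j}.ncard ≤ Q * (ε * n) := by nlinarith
  exact le_of_mul_le_mul_left h6 hQ0

/-- Vitali selection: a disjoint subfamily of cores whose middle sets absorb the whole family. -/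
lemma exists_vitali [SecondCountableTopology X] (t : Set ι) :
    ∃ u ⊆ t, u.Countable ∧ u.PairwiseDisjoint S.core ∧
    ∀ i ∈ t, ∃ j ∈ u, S.ord j ≤ S.ord i ∧ S.core i ⊆ S.mid j := by
  obtain ⟨u, hut, hd, hu⟩ := Vitali.exists_disjoint_subfamily_covering_enlargement S.core t
    (fun i => (1 / 2 : ℝ) ^ S.ord i) (3 / 2) (by norm_num) (fun _ _ => by positivity) 1
    (fun _ _ => pow_le_one₀ (by norm_num) (by norm_num)) (fun i _ => S.nonempty_core i)
  refine ⟨u, hut, hd.countable_of_isOpen (fun i _ => S.isOpen_core i)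
    (fun i _ => S.nonempty_core i), hd, fun i hi => ?_⟩
  obtain ⟨j, hj, hij, hle⟩ := hu i hi
  have hord : S.ord j ≤ S.ord i := by
    by_contra! hlt
    have h1 : (1 / 2 : ℝ) ^ S.ord j ≤ (1 / 2) ^ (S.ord i + 1) :=
      pow_le_pow_of_le_one (by norm_num) (by norm_num) hlt
    have h2 : (0 : ℝ) < (1 / 2) ^ S.ord i := by positivity
    rw [pow_succ] at h1
    linarith
  exact ⟨j, hj, hord, S.core_subset_mid_of_inter j i hord hij⟩

variable [OpensMeasurableSpace X]

/-- A disjoint family of cores inside `T` has middle sets of total measure at most `C * μ T`. -/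
lemma tsum_measure_mid_le {u : Set ι} (hu : u.Countable) (hd : u.PairwiseDisjoint S.core)
    {T : Set X} (hT : ∀ i ∈ u, S.core i ⊆ T) :
    ∑' i : u, μ (S.mid i) ≤ C * μ T := by
  calc ∑' i : u, μ (S.mid i) ≤ ∑' i : u, C * μ (S.core i) :=
        ENNReal.tsum_le_tsum fun i => S.measure_mid_le i
    _ = C * ∑' i : u, μ (S.core i) := ENNReal.tsum_mul_left
    _ = C * μ (⋃ i ∈ u, S.core i) := by
        rw [measure_biUnion hu hd fun i _ => (S.isOpen_core i).measurableSet]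
    _ ≤ _ := by gcongr; exact Set.iUnion₂_subset hT

lemma measurableSet_visit (n : ℕ) : MeasurableSet (S.visit n) :=
  (isOpen_iUnion fun i => isOpen_iUnion fun _ => S.isOpen_core i).measurableSet

lemma measurable_count (s N : ℕ) : Measurable (S.count s N) :=
  Finset.measurable_fun_sum _ fun n _ => measurable_const.indicator (S.measurableSet_visit n)

lemma measurable_pow_count (β : ℝ≥0∞) (s N : ℕ) : Measurable fun x => β ^ S.count s N x :=
  (measurable_from_nat (f := fun n => β ^ n)).comp (S.measurable_count s N)

variable [SecondCountableTopology X]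

/-- Decomposition according to the first time `≥ s` that counts: a bound for the exponential
moments that start at the order of a middle set gives a bound for those started at any time. -/
lemma lintegral_pow_count_le {β Ψ : ℝ≥0∞} {s N : ℕ} {T T' : Set X}
    (hT : ∀ j, s ≤ S.ord j → (S.core j ∩ T).Nonempty → S.core j ⊆ T') (hβ : 1 ≤ β)
    (hΨ : ∀ j, s ≤ S.ord j → ∫⁻ x in S.mid j, β ^ S.count (S.ord j) N x ∂μ ≤ Ψ * μ (S.mid j)) :
    ∫⁻ x in T, β ^ S.count s N x ∂μ ≤ μ T + Ψ * (C * μ T') := by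
  obtain ⟨u, hut, huc, hud, hu⟩ := S.exists_vitali {j | s ≤ S.ord j ∧ (S.core j ∩ T).Nonempty}
  have := huc.to_subtype
  let g : u → X → ℝ≥0∞ := fun j => (S.mid j).indicator fun x => β ^ S.count (S.ord j) N x
  have hg : ∀ j, Measurable (g j) := fun j =>
    (S.measurable_pow_count β _ N).indicator (S.measurableSet_mid j)
  have hpt : ∀ x ∈ T, β ^ S.count s N x ≤ 1 + ∑' j, g j x := by
    intro x hx
    by_cases h0 : S.count s N x = 0
    · simp [h0]
    obtain ⟨i, his, hxi, hi⟩ := S.exists_core_of_count_ne_zero h0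
    obtain ⟨j, hj, hji, hij⟩ := hu i ⟨his, x, hxi, hx⟩
    refine le_add_left (le_trans ?_ (ENNReal.le_tsum (⟨j, hj⟩ : u)))
    simp only [g]
    rw [Set.indicator_of_mem (hij hxi)]
    exact pow_le_pow_right₀ hβ (hi.trans (S.count_anti hji N x))
  calc ∫⁻ x in T, β ^ S.count s N x ∂μ ≤ ∫⁻ x in T, 1 + ∑' j, g j x ∂μ :=
        setLIntegral_mono (measurable_const.add (.tsum hg)) hpt
    _ = μ T + ∑' j, ∫⁻ x in T, g j x ∂μ := by
        rw [lintegral_add_left measurable_const, lintegral_tsum fun j => (hg j).aemeasurable]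
        simp
    _ ≤ μ T + ∑' j : u, Ψ * μ (S.mid j) := by
        gcongr with j
        refine (setLIntegral_le_lintegral _ _).trans ?_
        rw [lintegral_indicator (S.measurableSet_mid j)]
        exact hΨ j (hut j.2).1
    _ ≤ _ := by
        rw [ENNReal.tsum_mul_left]
        gcongr
        exact S.tsum_measure_mid_le huc hud fun i hi => hT i (hut hi).1 (hut hi).2

/-- The integral over the points of a middle set which lie in a core of order `n`, in terms of the
points whose `n`-th iterate is in `A`, and of the measure of the complement of `A`. -/
lemma lintegral_mid_inter_visit_le {Ξ : ℝ≥0∞} {g : X → ℝ≥0∞} {i : ι} {n : ℕ}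
    (hn : S.ord i ≤ n) (hf : Measurable f)
    (hg : ∀ j, S.ord j = n → ∫⁻ x in S.mid j, g x ∂μ ≤ Ξ * μ (S.mid j))
    {A : Set X} (hA : MeasurableSet A) :
    ∫⁻ x in S.mid i ∩ S.visit n, g x ∂μ ≤
      Ξ * (C * (K * μ (S.outer i) * μ (f^[n - S.ord i] ⁻¹' A)
        + K * C * μ Aᶜ * μ (S.outer i))) := by
  obtain ⟨u, hut, huc, hud, hu⟩ :=
    S.exists_vitali {j | S.ord j = n ∧ (S.core j ∩ S.mid i).Nonempty}
  have := huc.to_subtype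
  have hsub : ∀ j ∈ u, S.core j ⊆ S.outer i := fun j hj =>
    S.core_subset_outer_of_inter i j (hn.trans_eq (hut hj).1.symm) (hut hj).2
  have hdisj : Pairwise (Function.onFun Disjoint fun j : u => S.core j) := fun a b hab =>
    hud a.2 b.2 fun h => hab (Subtype.ext h)
  have hcore : ∑' j : u, μ (S.core j) ≤ K * μ (S.outer i) * μ (f^[n - S.ord i] ⁻¹' A)
        + K * C * μ Aᶜ * μ (S.outer i) := by
    have hAn : MeasurableSet (f^[n] ⁻¹' A) := hf.iterate n hA
    calc ∑' j : u, μ (S.core j)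
        = ∑' j : u, (μ (S.core j ∩ f^[n] ⁻¹' A) + μ (S.core j \ f^[n] ⁻¹' A)) := by
          simp only [measure_inter_add_sdiff _ hAn]
      _ = ∑' j : u, μ (S.core j ∩ f^[n] ⁻¹' A) + ∑' j : u, μ (S.core j \ f^[n] ⁻¹' A) :=
          ENNReal.tsum_add
      _ ≤ μ (S.outer i ∩ f^[n] ⁻¹' A) + ∑' j : u, K * C * μ Aᶜ * μ (S.core j) := by
          gcongr with j
          · rw [← measure_iUnion (fun a b hab => (hdisj hab).mono Set.inter_subset_left
              Set.inter_subset_left) fun j => (S.isOpen_core j).measurableSet.inter hAn]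
            exact measure_mono (Set.iUnion_subset fun j =>
              Set.inter_subset_inter_left _ (hsub j j.2))
          · have h1 := S.measure_outer_inter_preimage_le j Aᶜ hA.compl
            rw [(hut j.2).1] at h1
            calc μ (S.core j \ f^[n] ⁻¹' A) ≤ μ (S.outer j ∩ f^[n] ⁻¹' Aᶜ) :=
                  measure_mono fun x hx =>
                    ⟨S.mid_subset_outer _ (S.core_subset_mid _ hx.1), hx.2⟩
              _ ≤ K * (C * μ (S.core j)) * μ Aᶜ := h1.trans (by gcongr; exact S.measure_outer_le j)
              _ = _ := by ring
      _ ≤ _ := by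
          gcongr
          · have h1 := S.measure_outer_inter_preimage_le i _ (hf.iterate (n - S.ord i) hA)
            rwa [← Set.preimage_comp, ← Function.iterate_add, Nat.sub_add_cancel hn] at h1
          · rw [ENNReal.tsum_mul_left]
            gcongr
            rw [← measure_iUnion hdisj fun j => (S.isOpen_core j).measurableSet]
            exact measure_mono (Set.iUnion_subset fun j => hsub j j.2)
  calc ∫⁻ x in S.mid i ∩ S.visit n, g x ∂μ ≤ ∫⁻ x in ⋃ j : u, S.mid j, g x ∂μ := by
        refine lintegral_mono_set ?_
        rintro x ⟨hx, hxn⟩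
        obtain ⟨k, hk, hxk⟩ := S.mem_visit.1 hxn
        obtain ⟨j, hj, -, hkj⟩ := hu k ⟨hk, x, hxk, hx⟩
        exact Set.mem_iUnion.2 ⟨⟨j, hj⟩, hkj hxk⟩
    _ ≤ ∑' j : u, ∫⁻ x in S.mid j, g x ∂μ := lintegral_iUnion_le _ _
    _ ≤ ∑' j : u, Ξ * (C * μ (S.core j)) :=
        ENNReal.tsum_le_tsum fun j => (hg j (hut j.2).1).trans (by
          gcongr; exact S.measure_mid_le j)
    _ ≤ _ := by
        rw [ENNReal.tsum_mul_left, ENNReal.tsum_mul_left]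
        gcongr

/-- One step of the recursion for exponential moments: the window of length `w` which starts at
the order of the middle set is split off. By the choice of `A` few of its points have many visits
during the window. -/
lemma lintegral_mid_pow_count_le {β c R Ξ ε : ℝ≥0∞} {w N : ℕ} (i : ι) (hf : Measurable f)
    {A : Set X} (hA : MeasurableSet A) (hAc : μ Aᶜ ≤ ε)
    (hAw : ∑ k ∈ Finset.range w, μ (f^[k] ⁻¹' A) ≤ ε * w)
    (hβ : 1 ≤ β) (hβc : ∀ a ≤ w, β ^ a ≤ c + R * a)
    (hΞ : ∀ j, S.ord j ≤ S.ord i + w →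
      ∫⁻ x in S.mid j, β ^ S.count (S.ord i + w) N x ∂μ ≤ Ξ * μ (S.mid j)) :
    ∫⁻ x in S.mid i, β ^ S.count (S.ord i) N x ∂μ ≤
      (c + R * (w * (C * (K * C * ε + K * C * C * ε)))) * Ξ * μ (S.mid i) := by
  classical
  set m := S.ord i with hm
  set g : X → ℝ≥0∞ := fun x => β ^ S.count (m + w) N x with hg
  have hgm : Measurable g := S.measurable_pow_count β _ N
  have hpt : ∀ x, β ^ S.count m N x ≤ c * g x +
      R * ∑ n ∈ Finset.Ico m (m + w), (S.visit n).indicator g x := by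
    intro x
    calc β ^ S.count m N x ≤ β ^ (S.count m (m + w) x + S.count (m + w) N x) :=
          pow_le_pow_right₀ hβ (S.count_le_add _ _ _ (Nat.le_add_right _ _) x)
      _ ≤ (c + R * S.count m (m + w) x) * g x := by
          rw [pow_add]
          gcongr
          exact hβc _ (S.count_le m w x)
      _ = _ := by
          rw [add_mul, mul_assoc, count, Nat.cast_sum, Finset.sum_mul]
          congr 2
          refine Finset.sum_congr rfl fun n _ => ?_
          by_cases hx : x ∈ S.visit n <;> simp [hx]
  have hvis : ∀ n ∈ Finset.Ico m (m + w), ∫⁻ x in S.mid i, (S.visit n).indicator g x ∂μ ≤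
      Ξ * (C * (K * μ (S.outer i) * μ (f^[n - m] ⁻¹' A) + K * C * μ Aᶜ * μ (S.outer i))) := by
    intro n hn
    rw [Finset.mem_Ico] at hn
    rw [setLIntegral_indicator (S.measurableSet_visit n), Set.inter_comm]
    exact S.lintegral_mid_inter_visit_le hn.1 hf (fun j hj => hΞ j (hj.trans_le hn.2.le)) hA
  calc ∫⁻ x in S.mid i, β ^ S.count m N x ∂μ
      ≤ ∫⁻ x in S.mid i, c * g x + R * ∑ n ∈ Finset.Ico m (m + w), (S.visit n).indicator g x ∂μ :=
        lintegral_mono hpt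
    _ = c * ∫⁻ x in S.mid i, g x ∂μ +
        R * ∑ n ∈ Finset.Ico m (m + w), ∫⁻ x in S.mid i, (S.visit n).indicator g x ∂μ := by
        have hi : ∀ n, Measurable ((S.visit n).indicator g) := fun n =>
          hgm.indicator (S.measurableSet_visit n)
        rw [lintegral_add_left (hgm.const_mul c), lintegral_const_mul _ hgm,
          lintegral_const_mul _ (Finset.measurable_fun_sum _ fun n _ => hi n),
          lintegral_finsetSum _ fun n _ => hi n]
    _ ≤ c * (Ξ * μ (S.mid i)) + R * ∑ n ∈ Finset.Ico m (m + w),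
        Ξ * (C * (K * μ (S.outer i) * μ (f^[n - m] ⁻¹' A) + K * C * μ Aᶜ * μ (S.outer i))) := by
        gcongr with n hn
        · exact hΞ i (Nat.le_add_right _ _)
        · exact hvis n hn
    _ = c * (Ξ * μ (S.mid i)) + R * (Ξ * (C * (K * μ (S.outer i) *
          (∑ k ∈ Finset.range w, μ (f^[k] ⁻¹' A)) + w * (K * C * μ Aᶜ * μ (S.outer i))))) := by
        rw [← Finset.mul_sum, ← Finset.mul_sum, Finset.sum_add_distrib, ← Finset.mul_sum,
          Finset.sum_Ico_eq_sum_range]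
        simp
    _ ≤ c * (Ξ * μ (S.mid i)) + R * (Ξ * (C * (K * (C * μ (S.mid i)) *
          (ε * w) + w * (K * C * ε * (C * μ (S.mid i)))))) := by
        gcongr <;> exact S.measure_outer_le_mid i
    _ = _ := by ring

/-- Exponential moments of the number of visits grow at most geometrically in the number of
windows. -/
lemma lintegral_pow_count_le_pow {β c R ε : ℝ≥0∞} {w N : ℕ} (hf : Measurable f)
    {A : Set X} (hA : MeasurableSet A) (hAc : μ Aᶜ ≤ ε)
    (hAw : ∑ k ∈ Finset.range w, μ (f^[k] ⁻¹' A) ≤ ε * w)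
    (hβ : 1 ≤ β) (hβc : ∀ a ≤ w, β ^ a ≤ c + R * a) (k : ℕ) :
    ∀ i s, S.ord i ≤ s → N ≤ s + k * w → ∫⁻ x in S.mid i, β ^ S.count s N x ∂μ ≤
      (1 + C * C * (c + R * (w * (C * (K * C * ε + K * C * C * ε))))) ^ k * μ (S.mid i) := by
  set γ := c + R * (w * (C * (K * C * ε + K * C * C * ε)))
  induction k with
  | zero =>
    intro i s _ hN
    have : ∀ x, S.count s N x = 0 := fun x => by
      rw [count, Finset.Ico_eq_empty_of_le (by simpa using hN), Finset.sum_empty]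
    simp [this]
  | succ k ih =>
    intro i s his hN
    have h1 : ∀ j, s ≤ S.ord j → ∫⁻ x in S.mid j, β ^ S.count (S.ord j) N x ∂μ ≤
        γ * (1 + C * C * γ) ^ k * μ (S.mid j) := fun j hj =>
      S.lintegral_mid_pow_count_le j hf hA hAc hAw hβ hβc fun l hl =>
        ih l _ hl (by rw [add_mul] at hN; omega)
    calc ∫⁻ x in S.mid i, β ^ S.count s N x ∂μ
        ≤ μ (S.mid i) + γ * (1 + C * C * γ) ^ k * (C * μ (S.outer i)) :=
          S.lintegral_pow_count_le (fun j hj => S.core_subset_outer_of_inter i j (his.trans hj))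
            hβ h1
      _ ≤ (1 + C * C * γ) ^ k * μ (S.mid i) +
          γ * (1 + C * C * γ) ^ k * (C * (C * μ (S.mid i))) := by
          gcongr
          · exact le_mul_of_one_le_left' (one_le_pow₀ le_self_add)
          · exact S.measure_outer_le_mid i
      _ = _ := by ring

/-- If sets of almost full measure are rarely visited by the orbits, then the visits to the cores
have frequency at most `1 / Q`, for every `Q`: their number has a geometrically small probability
of being large. -/
theorem ae_eventually_count_lt [IsFiniteMeasure μ] (hf : Measurable f) (hC : C ≠ ⊤) (hK : K ≠ ⊤)
    (hrare : ∀ ε : ℝ≥0∞, 0 < ε → ∃ A, MeasurableSet A ∧ μ Aᶜ ≤ ε ∧ ∃ N : ℕ, 0 < N ∧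
      ∑ i ∈ Finset.range N, μ (f^[i] ⁻¹' A) ≤ ε * N) (Q : ℕ) :
    ∃ w : ℕ, 0 < w ∧ ∀ᵐ x ∂μ, ∀ᶠ k : ℕ in atTop, Q * S.count 0 (k * w) x < k * w := by
  -- `c ^ 2` beats twice the growth rate `1 + C ^ 2 * (c + 1)` of the exponential moments
  set c : ℝ≥0∞ := 2 * (C * C) + 4 with hc
  have hc1 : 1 ≤ c := le_add_left (by norm_num)
  have hctop : c ≠ ⊤ := by finiteness
  set M : ℝ≥0∞ := c ^ (2 * Q) * (2 * Q) * (C * (K * C + K * C * C)) with hM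
  have hMtop : M ≠ ⊤ := by finiteness
  obtain ⟨A, hA, hAc, w, hw, hAw⟩ := hrare M⁻¹ (ENNReal.inv_pos.2 hMtop)
  refine ⟨w, hw, ?_⟩
  set ε := M⁻¹
  have hwR : (0 : ℝ) < w := by exact_mod_cast hw
  have hw0 : (w : ℝ≥0∞) ≠ 0 := by exact_mod_cast hw.ne'
  have hwtop : (w : ℝ≥0∞) ≠ ⊤ := ENNReal.natCast_ne_top w
  set β : ℝ≥0∞ := c ^ ((2 * Q : ℝ) / w) with hβdef
  have hβpow : ∀ a : ℕ, β ^ a = c ^ ((2 * Q : ℝ) / w * a) := fun a => by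
    rw [hβdef, ENNReal.rpow_mul, ENNReal.rpow_natCast]
  have hβ : 1 ≤ β := by
    have h : (0 : ℝ) ≤ (2 * Q : ℝ) / w := by positivity
    simpa using ENNReal.rpow_le_rpow_of_exponent_le hc1 h
  set R : ℝ≥0∞ := c ^ (2 * Q) * (2 * Q) / w with hR
  have hβc : ∀ a ≤ w, β ^ a ≤ c + R * a := by
    intro a ha
    rw [hβpow]
    rcases lt_or_ge (2 * Q * a) w with h | h
    · refine le_add_right ?_
      calc c ^ ((2 * Q : ℝ) / w * a) ≤ c ^ (1 : ℝ) := by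
            refine ENNReal.rpow_le_rpow_of_exponent_le hc1 ?_
            rw [div_mul_eq_mul_div, div_le_one hwR]
            exact_mod_cast h.le
        _ = c := ENNReal.rpow_one c
    · refine le_add_left ?_
      calc c ^ ((2 * Q : ℝ) / w * a) ≤ c ^ ((2 * Q : ℕ) : ℝ) := by
            refine ENNReal.rpow_le_rpow_of_exponent_le hc1 ?_
            rw [div_mul_eq_mul_div, div_le_iff₀ hwR]
            push_cast
            gcongr
        _ = c ^ (2 * Q) := ENNReal.rpow_natCast _ _
        _ ≤ c ^ (2 * Q) * ((2 * Q * a : ℕ) / w) := by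
            refine le_mul_of_one_le_right' ?_
            rw [ENNReal.le_div_iff_mul_le (Or.inl hw0) (Or.inl hwtop), one_mul]
            exact_mod_cast h
        _ = R * a := by
            rw [hR, div_eq_mul_inv, div_eq_mul_inv]
            push_cast
            ring
  set Γ := 1 + C * C * (c + R * (w * (C * (K * C * ε + K * C * C * ε)))) with hΓ
  have hΓc : 2 * Γ ≤ c ^ 2 := by
    have h1 : R * (w * (C * (K * C * ε + K * C * C * ε))) ≤ 1 := by
      calc R * (w * (C * (K * C * ε + K * C * C * ε)))
          = (R * w) * (C * (K * C + K * C * C)) * ε := by ring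
        _ = M * ε := by rw [hR, ENNReal.div_mul_cancel hw0 hwtop]
        _ ≤ 1 := ENNReal.mul_inv_le_one M
    calc 2 * Γ ≤ 2 * (1 + C * C * (c + 1)) := by rw [hΓ]; gcongr
      _ ≤ 2 * (1 + C * C * (c + 1)) + (6 * (C * C) + 14) := le_self_add
      _ = c ^ 2 := by rw [hc]; ring
  have hint : ∀ k, ∫⁻ x, β ^ S.count 0 (k * w) x ∂μ ≤ (1 + C) * Γ ^ k * μ Set.univ := by
    intro k
    have h1 := S.lintegral_pow_count_le (β := β) (s := 0) (N := k * w) (T := Set.univ)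
      (T' := Set.univ) (Ψ := Γ ^ k) (fun _ _ _ => Set.subset_univ _) hβ fun j _ =>
        S.lintegral_pow_count_le_pow hf hA hAc hAw hβ hβc k j _ le_rfl (Nat.le_add_left _ _)
    rw [Measure.restrict_univ] at h1
    refine h1.trans ?_
    calc μ Set.univ + Γ ^ k * (C * μ Set.univ)
        ≤ Γ ^ k * μ Set.univ + Γ ^ k * (C * μ Set.univ) := by
          gcongr
          exact le_mul_of_one_le_left' (one_le_pow₀ le_self_add)
      _ = _ := by ring
  have hbad : ∀ k, μ {x | k * w ≤ Q * S.count 0 (k * w) x} ≤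
      (1 + C) * μ Set.univ * (2⁻¹ : ℝ≥0∞) ^ k := by
    intro k
    have hc2 : c ^ (2 * k) ≠ 0 := pow_ne_zero _ (zero_lt_one.trans_le hc1).ne'
    have hc2t : c ^ (2 * k) ≠ ⊤ := by finiteness
    have h1 : c ^ (2 * k) * μ {x | k * w ≤ Q * S.count 0 (k * w) x} ≤
        (1 + C) * Γ ^ k * μ Set.univ := by
      refine le_trans ?_ (hint k)
      refine le_trans ?_ (mul_meas_ge_le_lintegral (S.measurable_pow_count β _ _) (c ^ (2 * k)))
      gcongr with x
      intro hx
      rw [hβpow, ← ENNReal.rpow_natCast]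
      refine ENNReal.rpow_le_rpow_of_exponent_le hc1 ?_
      rw [div_mul_eq_mul_div, le_div_iff₀ hwR]
      have : (k * w : ℝ) ≤ Q * S.count 0 (k * w) x := by exact_mod_cast hx
      push_cast
      linarith
    have h2 : Γ ^ k ≤ c ^ (2 * k) * (2⁻¹ : ℝ≥0∞) ^ k := by
      rw [pow_mul, ← mul_pow]
      gcongr
      rw [← div_eq_mul_inv, ENNReal.le_div_iff_mul_le (by simp) (by simp), mul_comm]
      exact hΓc
    refine (ENNReal.mul_le_mul_iff_right hc2 hc2t).1 (h1.trans ?_)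
    calc (1 + C) * Γ ^ k * μ Set.univ
        ≤ (1 + C) * (c ^ (2 * k) * (2⁻¹ : ℝ≥0∞) ^ k) * μ Set.univ := by gcongr
      _ = _ := by ring
  have hsum : ∑' k, μ {x | k * w ≤ Q * S.count 0 (k * w) x} ≠ ⊤ := by
    refine ne_top_of_le_ne_top ?_ (ENNReal.tsum_le_tsum hbad)
    rw [ENNReal.tsum_mul_left, ENNReal.tsum_geometric, ENNReal.one_sub_inv_two, inv_inv]
    finiteness
  filter_upwards [ae_eventually_notMem hsum] with x hx
  filter_upwards [hx] with k hk
  simpa using hk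

/-- Positive upper frequency of visits to the cores forces the existence of an absolutely
continuous invariant probability measure. -/
theorem exists_invariant [IsFiniteMeasure μ] (hμ : μ ≠ 0)
    (hf : Measure.QuasiMeasurePreserving f μ μ) (hC : C ≠ ⊤) (hK : K ≠ ⊤)
    {Z : ℕ → Set X} (hZ : ∀ᵐ x ∂μ, ∀ j, x ∈ Z j → x ∈ S.visit j)
    (hfreq : ∀ᵐ x ∂μ, 0 <
      limsup (fun n : ℕ => (({j : ℕ | 1 ≤ j ∧ j ≤ n ∧ x ∈ Z j}.ncard : ℝ) / n)) atTop) :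
    ∃ ν : Measure X, IsProbabilityMeasure ν ∧ MeasurePreserving f ν ν ∧ ν ≪ μ := by
  refine (exists_invariant_or_rarely_visited μ hf).resolve_right fun hrare => ?_
  have := ae_neBot.2 hμ
  choose w hw hQ using S.ae_eventually_count_lt hf.measurable hC hK hrare
  obtain ⟨x, h1, h2, h3⟩ := (hZ.and (hfreq.and (ae_all_iff.2 hQ))).exists
  exact absurd h2 (not_lt.2 (S.limsup_frequency_le_zero h1 fun Q => ⟨w Q, hw Q, h3 Q⟩))

end CoveringSystem

/-! ### Geometry of zooming pre-balls -/

namespace IsZoomingContraction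

variable {α : ℕ → ℝ≥0 → ℝ≥0} (hα : IsZoomingContraction α)
include hα

lemma le_self {n : ℕ} (hn : 1 ≤ n) (r : ℝ≥0) : α n r ≤ r := by
  rcases eq_or_lt_of_le (zero_le (a := r)) with rfl | hr
  · refine le_of_forall_pos_le_add fun ε hε => ?_
    rw [zero_add]
    exact (hα.mono n hn hε.le).trans (hα.lt_self n hn ε hε).le
  · exact (hα.lt_self n hn r hr).le

lemma tendsto_zero : Tendsto (fun n => (α n 1 : ℝ≥0∞)) atTop (𝓝 0) := by
  have h : ∑' n : ℕ, (α (n + 1) 1 : ℝ≥0∞) ≠ ⊤ := by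
    refine ne_top_of_le_ne_top hα.sup_sum_lt_top.ne ?_
    exact le_iSup₂ (f := fun (r : ℝ≥0) (_ : r ≤ 1) => ∑' n : ℕ, (α (n + 1) r : ℝ≥0∞)) 1 le_rfl
  exact (tendsto_add_atTop_iff_nat 1).1 (ENNReal.tendsto_atTop_zero_of_tsum_ne_top h)

end IsZoomingContraction

namespace IsZoomingPreBall

variable {X : Type*} [MetricSpace X] {α : ℕ → ℝ≥0 → ℝ≥0} {δ : ℝ} {f : X → X} {n : ℕ} {p : X}
  {V : Set X}

lemma injOn (h : IsZoomingPreBall α δ f n p V) : Set.InjOn f^[n] (closure V) := by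
  obtain ⟨e, he⟩ := h.homeo
  intro x hx y hy hxy
  have : e ⟨x, hx⟩ = e ⟨y, hy⟩ := Subtype.ext (by rw [he, he]; exact hxy)
  simpa using e.injective this

lemma continuousOn (h : IsZoomingPreBall α δ f n p V) : ContinuousOn f^[n] (closure V) := by
  obtain ⟨e, he⟩ := h.homeo
  rw [continuousOn_iff_continuous_domRestrict]
  convert continuous_subtype_val.comp e.continuous using 1
  ext x
  exact (he x).symm

/-- A point of the closure that is mapped into the open ball lies in the pre-ball. -/
lemma mem_of_mem_closure (h : IsZoomingPreBall α δ f n p V) {x : X} (hx : x ∈ closure V)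
    (hfx : f^[n] x ∈ Metric.ball (f^[n] p) δ) : x ∈ V := by
  rw [← h.image_eq] at hfx
  obtain ⟨y, hy, hyx⟩ := hfx
  rwa [← h.injOn (subset_closure hy) hx hyx]

lemma isOpen_inter_preimage (h : IsZoomingPreBall α δ f n p V) {C : Set X} (hC : IsOpen C) :
    IsOpen (V ∩ f^[n] ⁻¹' C) :=
  (h.continuousOn.mono subset_closure).isOpen_inter_preimage h.isOpen hC

lemma image_inter_preimage (h : IsZoomingPreBall α δ f n p V) {C : Set X}
    (hC : C ⊆ Metric.ball (f^[n] p) δ) : f^[n] '' (V ∩ f^[n] ⁻¹' C) = C := by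
  rw [Set.image_inter_preimage, h.image_eq, Set.inter_eq_right.2 hC]

lemma isPreconnected_inter_preimage (h : IsZoomingPreBall α δ f n p V) {C : Set X}
    (hC : C ⊆ Metric.ball (f^[n] p) δ) (hCc : IsPreconnected C) :
    IsPreconnected (V ∩ f^[n] ⁻¹' C) := by
  obtain ⟨e, he⟩ := h.homeo
  have h1 : IsPreconnected (Subtype.val ⁻¹' C : Set (closure (Metric.ball (f^[n] p) δ))) := by
    rw [← Topology.IsInducing.subtypeVal.isPreconnected_image, Subtype.image_preimage_coe,
      Set.inter_eq_right.2 (hC.trans subset_closure)]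
    exact hCc
  have h2 := h1.image (fun z => (e.symm z : X))
    (continuous_subtype_val.comp e.symm.continuous).continuousOn
  convert h2 using 1
  ext x
  simp only [Set.mem_inter_iff, Set.mem_preimage, Set.mem_image]
  constructor
  · rintro ⟨hx, hxC⟩
    exact ⟨e ⟨x, subset_closure hx⟩, by rw [he]; exact hxC, by simp⟩
  · rintro ⟨z, hz, rfl⟩
    have h3 : f^[n] (e.symm z) = z := by rw [← he, e.apply_symm_apply]
    rw [h3]
    exact ⟨h.mem_of_mem_closure (e.symm z).2 (h3 ▸ hC hz), hz⟩

lemma dist_iterate_le (hα : IsZoomingContraction α) (h : IsZoomingPreBall α δ f n p V) {m : ℕ}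
    (hm : m ≤ n) {x y : X} (hx : x ∈ V) (hy : y ∈ V) :
    dist (f^[m] x) (f^[m] y) ≤ dist (f^[n] x) (f^[n] y) := by
  rcases hm.eq_or_lt with rfl | hlt
  · exact le_rfl
  · have := (h.contract x hx y hy m hlt).trans (hα.le_self (by omega) _)
    exact_mod_cast this

/-- A connected pullback of higher order is contained in every pre-ball that it meets sufficiently
far from the boundary. -/
lemma inter_preimage_subset (hα : IsZoomingContraction α) (h : IsZoomingPreBall α δ f n p V)
    {m : ℕ} {q : X} {V' : Set X} (h' : IsZoomingPreBall α δ f m q V') (hmn : m ≤ n) {r ε : ℝ}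
    {C : Set X} (hC : C ⊆ Metric.ball (f^[n] p) r) (hCc : IsPreconnected C) (hr : r ≤ δ)
    {x : X} (hx : x ∈ V ∩ f^[n] ⁻¹' C) (hxV : x ∈ V')
    (hxq : f^[m] x ∈ Metric.ball (f^[m] q) ε) (hε : ε + 2 * r ≤ δ) :
    V ∩ f^[n] ⁻¹' C ⊆ V' ∩ f^[m] ⁻¹' Metric.ball (f^[m] q) (ε + 2 * r) := by
  have hd : ∀ y ∈ V ∩ f^[n] ⁻¹' C, f^[m] y ∈ Metric.ball (f^[m] q) (ε + 2 * r) := by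
    intro y hy
    have h1 := h.dist_iterate_le hα hmn hy.1 hx.1
    have h2 := Metric.mem_ball.1 (hC hy.2)
    have h3 := Metric.mem_ball'.1 (hC hx.2)
    have h4 := dist_triangle (f^[n] y) (f^[n] p) (f^[n] x)
    have h5 := dist_triangle (f^[m] y) (f^[m] x) (f^[m] q)
    rw [Metric.mem_ball] at hxq ⊢
    linarith
  have hsub : V ∩ f^[n] ⁻¹' C ⊆ V' := by
    refine (h.isPreconnected_inter_preimage (hC.trans (Metric.ball_subset_ball hr))
      hCc).subset_of_closure_inter_subset h'.isOpen ⟨x, hx, hxV⟩ ?_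
    rintro y ⟨hy, hyC⟩
    exact h'.mem_of_mem_closure hy (Metric.ball_subset_ball hε (hd y hyC))
  exact fun y hy => ⟨hsub hy, hd y hy⟩

end IsZoomingPreBall

/-- In a compact locally connected space, connected open sets of small diameter contain balls of
a uniform radius. -/
lemma exists_uniform_connected_nhd {X : Type*} [MetricSpace X] [CompactSpace X]
    [LocallyConnectedSpace X] {r : ℝ} (hr : 0 < r) :
    ∃ s > 0, ∀ x : X, ∃ C : Set X, IsOpen C ∧ IsPreconnected C ∧
      Metric.ball x s ⊆ C ∧ C ⊆ Metric.ball x r := by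
  obtain ⟨s, hs, h⟩ := lebesgue_number_lemma_of_metric (isCompact_univ (X := X))
    (c := fun y => connectedComponentIn (Metric.ball y (r / 2)) y)
    (fun y => Metric.isOpen_ball.connectedComponentIn)
    (fun y _ => Set.mem_iUnion.2
      ⟨y, mem_connectedComponentIn (Metric.mem_ball_self (by positivity))⟩)
  refine ⟨s, hs, fun x => ?_⟩
  obtain ⟨y, hy⟩ := h x (Set.mem_univ x)
  refine ⟨_, Metric.isOpen_ball.connectedComponentIn, isPreconnected_connectedComponentIn, hy, ?_⟩
  have hxy := connectedComponentIn_subset _ _ (hy (Metric.mem_ball_self hs))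
  refine (connectedComponentIn_subset _ _).trans (Metric.ball_subset_ball' ?_)
  rw [Metric.mem_ball'] at hxy
  linarith

/-- Balls of a fixed radius around points of the support have measure bounded from below. -/
lemma exists_le_measure_ball {X : Type*} [MetricSpace X] [CompactSpace X] [MeasurableSpace X]
    (μ : Measure X) {s : ℝ} (hs : 0 < s) :
    ∃ b : ℝ≥0∞, b ≠ 0 ∧ b ≠ ⊤ ∧ ∀ x ∈ μ.support, b ≤ μ (Metric.ball x s) := by
  classical
  obtain ⟨F, -, hF, hcov⟩ := Metric.finite_approx_of_totallyBounded
    (isCompact_univ (X := X)).totallyBounded (s / 2) (by positivity)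
  set G := hF.toFinset.filter fun y => 0 < μ (Metric.ball y (s / 2))
  refine ⟨min 1 (G.inf fun y => μ (Metric.ball y (s / 2))), ?_, ?_, fun x hx => ?_⟩
  · refine (lt_min zero_lt_one ?_).ne'
    rw [Finset.lt_inf_iff (by simp)]
    exact fun y hy => (Finset.mem_filter.1 hy).2
  · exact ne_top_of_le_ne_top ENNReal.one_ne_top (min_le_left _ _)
  · obtain ⟨y, hy, hxy⟩ := Set.mem_iUnion₂.1 (hcov (Set.mem_univ x))
    have hpos : 0 < μ (Metric.ball y (s / 2)) :=
      (Measure.mem_support_iff_forall x).1 hx _ (Metric.isOpen_ball.mem_nhds hxy)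
    refine (min_le_right _ _).trans ((Finset.inf_le (Finset.mem_filter.2
      ⟨hF.mem_toFinset.2 hy, hpos⟩)).trans (measure_mono (Metric.ball_subset_ball' ?_)))
    rw [Metric.mem_ball'] at hxy
    linarith

/-! ### Bounded distortion -/

section Distortion

variable {X : Type*} [MeasurableSpace X]

/-- The image measure is proportional to the measure on `V`, up to the factor `D`. -/
def HasComparableImages (μ : Measure X) (g : X → X) (V : Set X) (D : ℝ≥0∞) : Prop :=
  ∀ A ⊆ V, MeasurableSet A → ∀ B ⊆ V, MeasurableSet B → μ (g '' A) * μ B ≤ D * μ A * μ (g '' B)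

lemma IsJacobianOn.hasComparableImages {μ : Measure X} [IsFiniteMeasure μ] {g : X → X} {V : Set X}
    {J : X → ℝ} (hJ : IsJacobianOn μ g V J) (hg : Set.InjOn g V)
    (hpos : ∀ᵐ x ∂(μ.restrict V), 0 < J x) {κ : ℝ}
    (hκ : ∀ᵐ x ∂(μ.restrict V), ∀ᵐ y ∂(μ.restrict V), |Real.log (J x / J y)| ≤ κ) :
    HasComparableImages μ g V (ENNReal.ofReal (Real.exp κ * Real.exp κ)) := by
  intro A hAV hA B hBV hB
  by_cases hVμ : μ V = 0
  · simp [measure_mono_null hBV hVμ]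
  have hne : (ae (μ.restrict V)).NeBot := ae_neBot.2 fun h =>
    hVμ (Measure.restrict_eq_zero.1 h)
  obtain ⟨z, hz, hzκ⟩ := (hpos.and hκ).exists
  -- up to the factor `exp κ`, the Jacobian is constant and equal to `J z`
  have hJz : ∀ᵐ x ∂(μ.restrict V), J x ≤ Real.exp κ * J z ∧ J z ≤ Real.exp κ * J x := by
    filter_upwards [hpos, hzκ] with x hx hxκ
    rw [abs_le, Real.log_div hz.ne' hx.ne'] at hxκ
    constructor
    · rw [← Real.log_le_log_iff hx (by positivity), Real.log_mul (Real.exp_pos _).ne' hz.ne',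
        Real.log_exp]
      linarith
    · rw [← Real.log_le_log_iff hz (by positivity), Real.log_mul (Real.exp_pos _).ne' hx.ne',
        Real.log_exp]
      linarith
  have hup : μ.real (g '' A) ≤ Real.exp κ * J z * μ.real A := by
    rw [hJ.measure_image A hAV hA (hg.mono hAV)]
    calc ∫ x in A, J x ∂μ ≤ ∫ x in A, Real.exp κ * J z ∂μ := by
          refine setIntegral_mono_ae_restrict (hJ.integrableOn.mono_set hAV)
            (integrable_const _) ?_
          exact (ae_restrict_of_ae_restrict_of_subset hAV hJz).mono fun x hx => hx.1
      _ = _ := by simp [mul_comm]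
  have hlo : J z * μ.real B ≤ Real.exp κ * μ.real (g '' B) := by
    rw [hJ.measure_image B hBV hB (hg.mono hBV), ← integral_const_mul]
    calc J z * μ.real B = ∫ x in B, J z ∂μ := by simp [mul_comm]
      _ ≤ _ := by
          refine setIntegral_mono_ae_restrict (integrable_const _)
            ((hJ.integrableOn.mono_set hBV).const_mul _) ?_
          exact (ae_restrict_of_ae_restrict_of_subset hBV hJz).mono fun x hx => hx.2
  have hreal : μ.real (g '' A) * μ.real B ≤
      Real.exp κ * Real.exp κ * μ.real A * μ.real (g '' B) := by
    calc μ.real (g '' A) * μ.real B ≤ Real.exp κ * J z * μ.real A * μ.real B := by gcongr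
      _ = Real.exp κ * μ.real A * (J z * μ.real B) := by ring
      _ ≤ Real.exp κ * μ.real A * (Real.exp κ * μ.real (g '' B)) := by gcongr
      _ = _ := by ring
  have h := ENNReal.ofReal_le_ofReal hreal
  rwa [ENNReal.ofReal_mul measureReal_nonneg, ENNReal.ofReal_mul (by positivity),
    ENNReal.ofReal_mul (by positivity), ofReal_measureReal, ofReal_measureReal,
    ofReal_measureReal, ofReal_measureReal] at h

end Distortion

/-! ### Restriction to invariant sets -/

section Restriction

variable {X : Type*} [MetricSpace X] [MeasurableSpace X] {f : X → X} {α : ℕ → ℝ≥0 → ℝ≥0} {δ : ℝ}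
  {μ : Measure X}

lemma IsZoomingMeasure.restrict (hμ : IsZoomingMeasure α δ f μ) {U : Set X}
    (hinv : f ⁻¹' U = U) :
    IsZoomingMeasure α δ f (μ.restrict U) where
  finite := by have := hμ.finite; infer_instance
  nonsingular := by
    refine ⟨hμ.nonsingular.measurable, Measure.AbsolutelyContinuous.mk fun s hs h => ?_⟩
    rw [Measure.restrict_apply hs] at h
    rw [Measure.map_apply hμ.nonsingular.measurable hs,
      Measure.restrict_apply (hμ.nonsingular.measurable hs), ← hinv, ← Set.preimage_inter]
    exact hμ.nonsingular.preimage_null h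
  infinite_times := ae_restrict_of_ae hμ.infinite_times
  frequency := ae_restrict_of_ae hμ.frequency

lemma HasBoundedZoomingDistortion.restrict (hdist : HasBoundedZoomingDistortion α δ f μ)
    {U : Set X} (hU : MeasurableSet U) (hinv : f ⁻¹' U = U) :
    HasBoundedZoomingDistortion α δ f (μ.restrict U) := by
  obtain ⟨ρ, hρ, h⟩ := hdist
  refine ⟨ρ, hρ, fun n => ae_restrict_of_ae ?_⟩
  have hinvn : f^[n] ⁻¹' U = U := by
    induction n with
    | zero => rfl
    | succ n ih => rw [Function.iterate_succ, Set.preimage_comp, ih, hinv]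
  filter_upwards [h n] with p hp hpZ
  obtain ⟨V, hV, J, hJ, hpos, hlog⟩ := hp hpZ
  have hle : (μ.restrict U).restrict V ≤ μ.restrict V :=
    Measure.restrict_mono subset_rfl Measure.restrict_le_self
  refine ⟨V, hV, J, ⟨Integrable.mono_measure hJ.integrableOn hle, fun A hAV hA hinj => ?_⟩,
    ae_mono hle hpos, ?_⟩
  · have himg : f^[n] '' A ∩ U = f^[n] '' (A ∩ U) := by
      rw [← Set.image_inter_preimage, hinvn]
    rw [measureReal_def, Measure.restrict_apply' hU, himg, ← measureReal_def,
      hJ.measure_image _ (Set.inter_subset_left.trans hAV) (hA.inter hU)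
        (hinj.mono Set.inter_subset_left), Measure.restrict_restrict hA]
  · filter_upwards [ae_mono hle hlog] with x hx
    exact ae_mono hle hx

end Restriction

/-! ### The covering system of a zooming measure -/

section ZoomingMeasure

variable {X : Type*} [MetricSpace X] [CompactSpace X] [LocallyConnectedSpace X]
  [MeasurableSpace X] [BorelSpace X] {f : X → X} {α : ℕ → ℝ≥0 → ℝ≥0} {δ : ℝ} {μ : Measure X}

/-- A weak zooming measure with bounded distortion carries a covering system indexed by the typical
points and their zooming times. Its cores are small connected pullbacks of sets which contain a
ball of uniform radius `s` around a point of the support. -/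
theorem exists_coveringSystem (hα : IsZoomingContraction α) (hδ : 0 < δ)
    (hμ : IsWeakZoomingMeasure α δ f μ) (hdist : HasBoundedZoomingDistortion α δ f μ) :
    ∃ (P : Set X) (s : ℝ) (C K : ℝ≥0∞), 0 < s ∧ C ≠ ⊤ ∧ K ≠ ⊤ ∧ (∀ᵐ p ∂μ, p ∈ P) ∧
      ∃ S : CoveringSystem {q : X × ℕ // q.1 ∈ P ∧ q.1 ∈ zoomingTimeSet α δ f q.2} μ f C K,
        ∀ i, S.ord i = i.1.2 ∧ i.1.1 ∈ S.core i ∧ f^[i.1.2] i.1.1 ∈ μ.support ∧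
          Metric.ball (f^[i.1.2] i.1.1) s ⊆ f^[i.1.2] '' S.core i ∧
          (∀ x ∈ S.core i, ∀ y ∈ S.core i, nndist x y ≤ α i.1.2 1) ∧
          ∀ A ⊆ S.core i, MeasurableSet A → μ (f^[i.1.2] '' A) * μ (S.core i) ≤ C * μ A := by
  have := hμ.finite
  obtain ⟨ρ, hρ, hJ⟩ := hdist
  -- the radii of the images: `r` for the cores, `3 * r` for the middle sets, `δ ≥ 5 * r`
  obtain ⟨r, hr0, hrδ, hr1⟩ : ∃ r : ℝ, 0 < r ∧ 5 * r ≤ δ ∧ 2 * r ≤ 1 :=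
    ⟨min (δ / 5) (1 / 2), by positivity, by linarith [min_le_left (δ / 5) (1 / 2)],
      by linarith [min_le_right (δ / 5) (1 / 2)]⟩
  obtain ⟨s, hs, hC⟩ := exists_uniform_connected_nhd (X := X) hr0
  choose Q hQo hQc hsQ hQr using hC
  obtain ⟨b, hb0, hbtop, hb⟩ := exists_le_measure_ball μ hs
  set D : ℝ≥0∞ := ENNReal.ofReal (Real.exp (ρ * (2 * δ)) * Real.exp (ρ * (2 * δ))) with hD
  have hDtop : D ≠ ⊤ := ENNReal.ofReal_ne_top
  set P : Set X := {p | (∀ n, f^[n] p ∈ μ.support) ∧ ∀ n, p ∈ zoomingTimeSet α δ f n →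
    ∃ V, IsZoomingPreBall α δ f n p V ∧ HasComparableImages μ f^[n] V D} with hP
  have hPae : ∀ᵐ p ∂μ, p ∈ P := by
    filter_upwards [ae_all_iff.2 fun n =>
        (hμ.nonsingular.iterate n).ae Measure.support_mem_ae, ae_all_iff.2 hJ] with p h1 h2
    refine ⟨h1, fun n hn => ?_⟩
    obtain ⟨V, hV, J, hJV, hpos, hlog⟩ := h2 n hn
    refine ⟨V, hV, hJV.hasComparableImages (hV.injOn.mono subset_closure) hpos ?_⟩
    have hball : ∀ x ∈ V, dist (f^[n] x) (f^[n] p) < δ := fun x hx => by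
      have := Set.mem_image_of_mem f^[n] hx
      rwa [hV.image_eq] at this
    filter_upwards [hlog, ae_restrict_mem hV.isOpen.measurableSet] with x hx hxV
    filter_upwards [hx, ae_restrict_mem hV.isOpen.measurableSet] with y hy hyV
    refine hy.trans ?_
    gcongr
    linarith [dist_triangle_right (f^[n] x) (f^[n] y) (f^[n] p), hball x hxV, hball y hyV]
  set ι := {q : X × ℕ // q.1 ∈ P ∧ q.1 ∈ zoomingTimeSet α δ f q.2} with hι
  have hch : ∀ i : ι, ∃ V, IsZoomingPreBall α δ f i.1.2 i.1.1 V ∧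
      HasComparableImages μ f^[i.1.2] V D := fun i => i.2.1.2 _ i.2.2
  choose V hV hVD using hch
  let core : ι → Set X := fun i => V i ∩ f^[i.1.2] ⁻¹' Q (f^[i.1.2] i.1.1)
  let mid : ι → Set X := fun i =>
    V i ∩ f^[i.1.2] ⁻¹' Metric.ball (f^[i.1.2] i.1.1) (r + 2 * r)
  have hQδ : ∀ x, Q x ⊆ Metric.ball x δ := fun x =>
    (hQr x).trans (Metric.ball_subset_ball (by linarith))
  have hcore_open : ∀ i, IsOpen (core i) := fun i => (hV i).isOpen_inter_preimage (hQo _)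
  have hmid_open : ∀ i, IsOpen (mid i) := fun i => (hV i).isOpen_inter_preimage Metric.isOpen_ball
  have hcoreV : ∀ i, core i ⊆ V i := fun i => Set.inter_subset_left
  have himage : ∀ i, f^[i.1.2] '' core i = Q (f^[i.1.2] i.1.1) := fun i =>
    (hV i).image_inter_preimage (hQδ _)
  have hb_core : ∀ i, b ≤ μ (f^[i.1.2] '' core i) := fun i => by
    rw [himage]
    exact (hb _ (i.2.1.1 _)).trans (measure_mono (hsQ _))
  have hmem : ∀ i, i.1.1 ∈ core i := fun i => ⟨(hV i).mem, hsQ _ (Metric.mem_ball_self hs)⟩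
  have hbC : μ Set.univ ≠ ⊤ := measure_ne_top μ _
  set C : ℝ≥0∞ := (b⁻¹ + 1) * (D * μ Set.univ) with hCdef
  have hbtop' : b⁻¹ ≠ ⊤ := ENNReal.inv_ne_top.2 hb0
  refine ⟨P, s, C, b⁻¹ * D, hs, by finiteness, by finiteness, hPae, ⟨fun i => i.1.2, core, mid, V,
    hcore_open, fun i => (hmid_open i).measurableSet,
    fun i => ⟨_, hmem i⟩, ?_, fun i => Set.inter_subset_left, ?_, ?_, ?_, ?_⟩,
    fun i => ⟨rfl, hmem i, i.2.1.1 _, (hsQ _).trans (himage i).ge, ?_, ?_⟩⟩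
  · exact fun i => Set.inter_subset_inter_right _ (Set.preimage_mono ((hQr _).trans
      (Metric.ball_subset_ball (by linarith))))
  · rintro i j hij ⟨x, hxj, hxi⟩
    exact (hV j).inter_preimage_subset hα (hV i) hij (hQr _) (hQc _) (by linarith) hxj hxi.1
      (hQr _ hxi.2) (by linarith)
  · rintro i j hij ⟨x, hxj, hxi⟩
    exact ((hV j).inter_preimage_subset hα (hV i) hij (hQr _) (hQc _) (by linarith) hxj hxi.1
      hxi.2 (by linarith)).trans Set.inter_subset_left
  · intro i
    have h1 := hVD i (core i) (hcoreV i) (hcore_open i).measurableSet (V i) subset_rfl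
      (hV i).isOpen.measurableSet
    have h2 : b * μ (V i) ≤ D * μ (core i) * μ Set.univ :=
      le_trans (by gcongr; exact hb_core i) (h1.trans (by gcongr; exact Set.subset_univ _))
    calc μ (V i) = b⁻¹ * (b * μ (V i)) := by
          rw [← mul_assoc, ENNReal.inv_mul_cancel hb0 hbtop, one_mul]
      _ ≤ (b⁻¹ + 1) * (D * μ (core i) * μ Set.univ) := by gcongr; exact le_self_add
      _ = _ := by rw [hCdef]; ring
  · intro i A hA
    have hm : MeasurableSet (V i ∩ f^[i.1.2] ⁻¹' A) :=
      (hV i).isOpen.measurableSet.inter (hμ.nonsingular.measurable.iterate _ hA)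
    have h1 := hVD i (V i) subset_rfl (hV i).isOpen.measurableSet _ Set.inter_subset_left hm
    have h2 : b * μ (V i ∩ f^[i.1.2] ⁻¹' A) ≤ D * μ (V i) * μ A := by
      refine le_trans ?_ (h1.trans ?_)
      · gcongr
        exact (hb_core i).trans (measure_mono (Set.image_mono (hcoreV i)))
      · gcongr
        rintro _ ⟨x, hx, rfl⟩
        exact hx.2
    calc μ (V i ∩ f^[i.1.2] ⁻¹' A) = b⁻¹ * (b * μ (V i ∩ f^[i.1.2] ⁻¹' A)) := by
          rw [← mul_assoc, ENNReal.inv_mul_cancel hb0 hbtop, one_mul]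
      _ ≤ b⁻¹ * (D * μ (V i) * μ A) := by gcongr
      _ = _ := by ring
  · -- pulling back contracts, and the image of the core has diameter at most `2 * r ≤ 1`
    intro x hx y hy
    have hn : 1 ≤ i.1.2 := i.2.2.1
    have h1 := (hV i).contract x hx.1 y hy.1 0 hn
    rw [Nat.sub_zero] at h1
    refine h1.trans (hα.mono _ hn ?_)
    have h2 := Metric.mem_ball.1 (hQr _ hx.2)
    have h3 := Metric.mem_ball'.1 (hQr _ hy.2)
    have h4 : dist (f^[i.1.2] x) (f^[i.1.2] y) ≤ 1 :=
      (dist_triangle _ _ _).trans ((add_le_add h2.le h3.le).trans (by linarith))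
    exact_mod_cast h4
  · intro A hA hAm
    have h1 := hVD i A (hA.trans (hcoreV i)) hAm (core i) (hcoreV i) (hcore_open i).measurableSet
    calc _ ≤ D * μ A * μ Set.univ := h1.trans (by gcongr; exact Set.subset_univ _)
      _ ≤ (b⁻¹ + 1) * (D * μ A * μ Set.univ) := le_mul_of_one_le_left' le_add_self
      _ = _ := by rw [hCdef]; ring

/-- A nonzero zooming measure with bounded distortion admits an absolutely continuous invariant
probability measure. -/
theorem exists_invariant_of_isZoomingMeasure (hα : IsZoomingContraction α) (hδ : 0 < δ)
    (hμ : IsZoomingMeasure α δ f μ) (hdist : HasBoundedZoomingDistortion α δ f μ) (h0 : μ ≠ 0) :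
    ∃ ν : Measure X, IsProbabilityMeasure ν ∧ MeasurePreserving f ν ν ∧ ν ≪ μ := by
  have := hμ.finite
  obtain ⟨P, s, C, K, hs, hC, hK, hP, S, hS⟩ :=
    exists_coveringSystem hα hδ hμ.toIsWeakZoomingMeasure hdist
  refine S.exists_invariant h0 hμ.nonsingular hC hK (Z := zoomingTimeSet α δ f) ?_ hμ.frequency
  filter_upwards [hP] with x hx j hj
  exact S.mem_visit.2 ⟨⟨(x, j), hx, hj⟩, (hS _).1, (hS _).2.1⟩

/-! ### Invariant sets contain balls -/

/-- A substitute for the density theorem: an invariant set of positive measure fills almost all of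
a ball of radius `s` around some point of the support. Otherwise every core would lose a definite
proportion outside the invariant set, and a disjoint family of cores which nearly covers the set
inside a tight open neighbourhood would lose too much. -/
lemma exists_radius_measure_ball_diff_le (hα : IsZoomingContraction α) (hδ : 0 < δ)
    (hμ : IsWeakZoomingMeasure α δ f μ) (hdist : HasBoundedZoomingDistortion α δ f μ) :
    ∃ s > 0, ∀ U, MeasurableSet U → f ⁻¹' U = U → μ U ≠ 0 → ∀ ε : ℝ≥0∞, ε ≠ 0 →
      ∃ x ∈ μ.support, μ (Metric.ball x s \ U) ≤ ε := by
  have := hμ.finite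
  obtain ⟨P, s, C, K, hs, hC, -, hP, S, hS⟩ := exists_coveringSystem hα hδ hμ hdist
  refine ⟨s, hs, fun U hU hinv hU0 ε hε => ?_⟩
  by_contra! hcon
  have hinvn : ∀ n, f^[n] ⁻¹' U = U := fun n => by
    induction n with
    | zero => rfl
    | succ n ih => rw [Function.iterate_succ, Set.preimage_comp, ih, hinv]
  -- the proportion of a core outside of `U` is bounded from below
  have hloss : ∀ i, ε * μ (S.core i) ≤ C * μ (S.core i \ U) := by
    intro i
    obtain ⟨-, -, hsupp, hball, -, himg⟩ := hS i
    refine le_trans ?_ (himg _ Set.sdiff_subset ((S.isOpen_core i).measurableSet.diff hU))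
    gcongr
    refine (hcon _ hsupp).le.trans (measure_mono ?_)
    rintro z ⟨hz, hzU⟩
    obtain ⟨y, hy, rfl⟩ := hball hz
    refine ⟨y, ⟨hy, fun hyU => hzU ?_⟩, rfl⟩
    rwa [← hinvn i.1.2] at hyU
  obtain ⟨η, hη0, hη⟩ := ENNReal.exists_nnreal_pos_mul_lt (a := C * C) (b := ε * μ U)
    (by finiteness) (mul_ne_zero hε hU0)
  obtain ⟨O, hUO, hO, -, hOη⟩ := hU.exists_isOpen_sdiff_lt (measure_ne_top μ U)
    (ε := η) (by exact_mod_cast hη0.ne')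
  obtain ⟨u, hut, huc, hud, hu⟩ := S.exists_vitali {i | S.core i ⊆ O}
  have := huc.to_subtype
  have hdisj : Pairwise (Function.onFun Disjoint fun j : u => S.core j \ U) := fun a b hab =>
    (hud a.2 b.2 fun h => hab (Subtype.ext h)).mono Set.sdiff_subset Set.sdiff_subset
  have hcover : μ U ≤ μ (⋃ j : u, S.mid j) := by
    refine measure_mono_ae ?_
    filter_upwards [hP, hμ.infinite_times] with x hxP hxZ hxU
    -- the cores at `x` shrink to `x` along its zooming times
    obtain ⟨e, he, heO⟩ := Metric.isOpen_iff.1 hO x (hUO hxU)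
    obtain ⟨N, hN⟩ := eventually_atTop.1 ((tendsto_order.1 hα.tendsto_zero).2 (ENNReal.ofReal e)
      (ENNReal.ofReal_pos.2 he))
    obtain ⟨n, hn, hNn⟩ := hxZ.exists_gt N
    obtain ⟨-, hmem, -, -, hdiam, -⟩ := hS ⟨(x, n), hxP, hn⟩
    have hsub : S.core ⟨(x, n), hxP, hn⟩ ⊆ O := fun y hy => heO (by
      have h1 := (ENNReal.coe_le_coe.2 (hdiam y hy x hmem)).trans_lt (hN n hNn.le)
      rwa [← edist_nndist, edist_lt_ofReal] at h1)
    obtain ⟨j, hj, -, hjs⟩ := hu _ hsub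
    exact Set.mem_iUnion.2 ⟨⟨j, hj⟩, hjs hmem⟩
  refine absurd hη (not_lt.2 ?_)
  calc ε * μ U ≤ ε * ∑' j : u, C * μ (S.core j) := by
        gcongr
        exact hcover.trans ((measure_iUnion_le _).trans
          (ENNReal.tsum_le_tsum fun j => S.measure_mid_le j))
    _ = C * ∑' j : u, ε * μ (S.core j) := by
        rw [ENNReal.tsum_mul_left, ENNReal.tsum_mul_left]
        ring
    _ ≤ C * ∑' j : u, C * μ (S.core j \ U) := by
        exact mul_le_mul' le_rfl (ENNReal.tsum_le_tsum fun j => hloss j)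
    _ = C * C * μ (⋃ j : u, S.core j \ U) := by
        rw [ENNReal.tsum_mul_left, mul_assoc,
          measure_iUnion hdisj fun j => (S.isOpen_core j).measurableSet.diff hU]
    _ ≤ C * C * η := by
        gcongr
        refine (measure_mono ?_).trans hOη.le
        exact Set.iUnion_subset fun j => Set.sdiff_subset_sdiff_left (hut j.2)
    _ = η * (C * C) := mul_comm _ _

/-- Finitely many balls of positive measure are such that every invariant set of positive measure
contains one of them up to a null set. -/
theorem exists_finset_balls (hα : IsZoomingContraction α) (hδ : 0 < δ)
    (hμ : IsWeakZoomingMeasure α δ f μ) (hdist : HasBoundedZoomingDistortion α δ f μ) :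
    ∃ (F : Finset X) (e : ℝ), (∀ y ∈ F, μ (Metric.ball y e) ≠ 0) ∧
      ∀ U, MeasurableSet U → f ⁻¹' U = U → μ U ≠ 0 → ∃ y ∈ F, μ (Metric.ball y e \ U) = 0 := by
  classical
  obtain ⟨s, hs, h⟩ := exists_radius_measure_ball_diff_le hα hδ hμ hdist
  obtain ⟨F, -, hF, hcov⟩ := Metric.finite_approx_of_totallyBounded
    (isCompact_univ (X := X)).totallyBounded (s / 2) (by positivity)
  set G := hF.toFinset.filter fun y => μ (Metric.ball y (s / 2)) ≠ 0
  refine ⟨G, s / 2, fun y hy => (Finset.mem_filter.1 hy).2, fun U hU hinv hU0 => ?_⟩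
  by_contra! hcon
  have hpos : 0 < G.inf fun y => μ (Metric.ball y (s / 2) \ U) := by
    rw [Finset.lt_inf_iff (by simp)]
    exact fun y hy => pos_iff_ne_zero.2 (hcon y hy)
  obtain ⟨ε, hε0, hε⟩ := exists_between hpos
  obtain ⟨x, hx, hxε⟩ := h U hU hinv hU0 ε hε0.ne'
  obtain ⟨y, hy, hxy⟩ := Set.mem_iUnion₂.1 (hcov (Set.mem_univ x))
  have hyG : y ∈ G := Finset.mem_filter.2 ⟨hF.mem_toFinset.2 hy,
    ((Measure.mem_support_iff_forall x).1 hx _ (Metric.isOpen_ball.mem_nhds hxy)).ne'⟩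
  refine absurd (hε.trans_le (Finset.inf_le hyG)) (not_lt.2 (le_trans (measure_mono ?_) hxε))
  refine Set.sdiff_subset_sdiff_left (Metric.ball_subset_ball' ?_)
  rw [Metric.mem_ball'] at hxy
  linarith

/-! ### Ergodic components -/

/-- On an indecomposable invariant set there is an ergodic absolutely continuous invariant
probability measure, and its basin covers the set. -/
lemma exists_ergodic_of_indecomposable (hα : IsZoomingContraction α) (hδ : 0 < δ)
    (hμ : IsZoomingMeasure α δ f μ) (hdist : HasBoundedZoomingDistortion α δ f μ) {U : Set X}
    (hU : MeasurableSet U) (hinv : f ⁻¹' U = U) (hU0 : μ U ≠ 0)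
    (hind : ∀ A, MeasurableSet A → f ⁻¹' A = A → μ (A ∩ U) = 0 ∨ μ (U \ A) = 0) :
    ∃ η : Measure X, (IsProbabilityMeasure η ∧ Ergodic f η ∧ η ≪ μ) ∧
      ∀ᵐ x ∂μ, x ∈ U → x ∈ measureBasin f η := by
  obtain ⟨ν, hν, hνf, hνμ⟩ := exists_invariant_of_isZoomingMeasure hα hδ (hμ.restrict hinv)
    (hdist.restrict hU hinv) (fun h => hU0 (Measure.restrict_eq_zero.1 h))
  have hnull : ∀ A, μ (A ∩ U) = 0 → ν A = 0 := fun A hA =>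
    hνμ (by rwa [Measure.restrict_apply' hU])
  have herg : Ergodic f ν := by
    refine ⟨hνf, ⟨fun A hA hAinv => ?_⟩⟩
    rw [eventuallyConst_set']
    rcases hind A hA hAinv with h | h
    · exact Or.inl (ae_eq_empty.2 (hnull A h))
    · refine Or.inr (ae_eq_univ.2 (hnull _ ?_))
      rwa [Set.inter_comm, ← Set.sdiff_eq]
  refine ⟨ν, ⟨hν, herg, hνμ.trans Measure.absolutelyContinuous_restrict⟩, ?_⟩
  rcases hind _ (measurableSet_measureBasin (ν := ν) hνf.measurable)
    (preimage_measureBasin f ν) with h | h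
  · exfalso
    have h1 := ae_mem_measureBasin herg
    have h2 := measure_eq_zero_iff_ae_notMem.1 (hnull _ h)
    obtain ⟨x, hx1, hx2⟩ := (h1.and h2).exists
    exact hx2 hx1
  · filter_upwards [measure_eq_zero_iff_ae_notMem.1 h] with x hx hxU
    by_contra hxB
    exact hx ⟨hxU, hxB⟩

/-- Decomposition of an invariant set, by induction on the number of balls that it contains: a
decomposable set splits into two invariant sets, each of which contains fewer balls. -/
lemma exists_finset_ergodic (hα : IsZoomingContraction α) (hδ : 0 < δ)
    (hμ : IsZoomingMeasure α δ f μ) (hdist : HasBoundedZoomingDistortion α δ f μ)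
    {F : Finset X} {e : ℝ} (hF : ∀ y ∈ F, μ (Metric.ball y e) ≠ 0)
    (hball : ∀ U, MeasurableSet U → f ⁻¹' U = U → μ U ≠ 0 →
      ∃ y ∈ F, μ (Metric.ball y e \ U) = 0) (k : ℕ) :
    ∀ U, MeasurableSet U → f ⁻¹' U = U →
      {y | y ∈ F ∧ μ (Metric.ball y e \ U) = 0}.ncard ≤ k →
      ∃ S : Finset (Measure X), (∀ η ∈ S, IsProbabilityMeasure η ∧ Ergodic f η ∧ η ≪ μ) ∧
        ∀ᵐ x ∂μ, x ∈ U → ∃ η ∈ S, x ∈ measureBasin f η := by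
  classical
  have hfin : ∀ U, {y | y ∈ F ∧ μ (Metric.ball y e \ U) = 0}.Finite := fun U =>
    F.finite_toSet.subset fun y hy => hy.1
  induction k with
  | zero =>
    intro U hU hinv hk
    refine ⟨∅, by simp, ?_⟩
    by_cases hU0 : μ U = 0
    · exact (measure_eq_zero_iff_ae_notMem.1 hU0).mono fun x hx hxU => absurd hxU hx
    · obtain ⟨y, hy⟩ := hball U hU hinv hU0
      rw [nonpos_iff_eq_zero, Set.ncard_eq_zero (hfin U)] at hk
      exact absurd hk (Set.nonempty_iff_ne_empty.1 ⟨y, hy⟩)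
  | succ k ih =>
    intro U hU hinv hk
    by_cases hU0 : μ U = 0
    · exact ⟨∅, by simp,
        (measure_eq_zero_iff_ae_notMem.1 hU0).mono fun x hx hxU => absurd hxU hx⟩
    by_cases hind : ∀ A, MeasurableSet A → f ⁻¹' A = A → μ (A ∩ U) = 0 ∨ μ (U \ A) = 0
    · obtain ⟨η, hη, hηU⟩ := exists_ergodic_of_indecomposable hα hδ hμ hdist hU hinv hU0 hind
      exact ⟨{η}, by simpa using hη, by simpa using hηU⟩
    push Not at hind
    obtain ⟨A, hA, hAinv, hA1, hA2⟩ := hind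
    -- an invariant subset whose complement in `U` has positive measure contains fewer balls
    have hless : ∀ B ⊆ U, MeasurableSet B → f ⁻¹' B = B → μ (U \ B) ≠ 0 →
        {y | y ∈ F ∧ μ (Metric.ball y e \ B) = 0}.ncard ≤ k := by
      intro B hBU hB hBinv hB0
      refine Nat.lt_succ_iff.1 (lt_of_lt_of_le (Set.ncard_lt_ncard ?_ (hfin U)) hk)
      obtain ⟨y, hyF, hy⟩ := hball (U \ B) (hU.diff hB)
        (by rw [Set.preimage_sdiff, hinv, hBinv]) hB0
      have hsub : {y | y ∈ F ∧ μ (Metric.ball y e \ B) = 0} ⊆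
          {y | y ∈ F ∧ μ (Metric.ball y e \ U) = 0} := fun z hz =>
        ⟨hz.1, measure_mono_null (Set.sdiff_subset_sdiff_right hBU) hz.2⟩
      refine (Set.ssubset_iff_of_subset hsub).2 ⟨y, ⟨hyF, ?_⟩, fun hyB => ?_⟩
      · exact measure_mono_null (Set.sdiff_subset_sdiff_right Set.sdiff_subset) hy
      · refine hF y hyF (measure_mono_null (fun z hz => ?_) (measure_union_null hyB.2 hy))
        by_cases hzB : z ∈ B
        · exact Or.inr ⟨hz, fun h => h.2 hzB⟩
        · exact Or.inl ⟨hz, hzB⟩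
    have hAU : MeasurableSet (A ∩ U) := hA.inter hU
    have hAUinv : f ⁻¹' (A ∩ U) = A ∩ U := by rw [Set.preimage_inter, hAinv, hinv]
    obtain ⟨S₁, hS₁, hU₁⟩ := ih (A ∩ U) hAU hAUinv
      (hless _ Set.inter_subset_right hAU hAUinv (by rwa [Set.sdiff_inter_self_eq_sdiff]))
    have hUAinv : f ⁻¹' (U \ A) = U \ A := by rw [Set.preimage_sdiff, hAinv, hinv]
    obtain ⟨S₂, hS₂, hU₂⟩ := ih (U \ A) (hU.diff hA) hUAinv
      (hless _ Set.sdiff_subset (hU.diff hA) hUAinv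
        (by rwa [Set.sdiff_sdiff_right_self, Set.inter_comm]))
    refine ⟨S₁ ∪ S₂, fun η hη => (Finset.mem_union.1 hη).elim (hS₁ η) (hS₂ η), ?_⟩
    filter_upwards [hU₁, hU₂] with x h1 h2 hxU
    by_cases hxA : x ∈ A
    · obtain ⟨η, hη, hx⟩ := h1 ⟨hxA, hxU⟩
      exact ⟨η, Finset.mem_union_left _ hη, hx⟩
    · obtain ⟨η, hη, hx⟩ := h2 ⟨hxU, hxA⟩
      exact ⟨η, Finset.mem_union_right _ hη, hx⟩

end ZoomingMeasure

theorem mainTheorem4 {X : Type*} [MetricSpace X] [CompactSpace X] [LocallyConnectedSpace X]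
    [MeasurableSpace X] [BorelSpace X]
    (f : X → X) (α : ℕ → ℝ≥0 → ℝ≥0) (hα : IsZoomingContraction α) (δ : ℝ) (hδ : 0 < δ)
    (μ : Measure X) (hμ : IsZoomingMeasure α δ f μ)
    (hdist : HasBoundedZoomingDistortion α δ f μ) :
    ∃ S : Finset (Measure X),
      (∀ η ∈ S, IsProbabilityMeasure η ∧ Ergodic f η ∧ η ≪ μ) ∧
      ∀ᵐ x ∂μ, ∃ η ∈ S, x ∈ measureBasin f η := by
  obtain ⟨F, e, hF, hball⟩ := exists_finset_balls hα hδ hμ.toIsWeakZoomingMeasure hdist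
  obtain ⟨S, hS, hcov⟩ := exists_finset_ergodic hα hδ hμ hdist hF hball _ Set.univ
    MeasurableSet.univ Set.preimage_univ le_rfl
  exact ⟨S, hS, hcov.mono fun x hx => hx (Set.mem_univ x)⟩
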